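/- Let $p$ be a prime with $p\equiv 3 \pmod 4$, $p>3$, and let $b\ge 2$ be an integer that is a quadratic nonresidue modulo $p$. Let $d$ be the multiplicative order of $b$ modulo $p$, let $g$ be a primitive root modulo $p$, and for $j=0,1,\dots,\frac{p-1}{d}-1$ let $b_j\in\{1,\dots,p-1\}$ be the least positive residue of $g^{2j}$ modulo $p$. Let $$\frac{b_j}{p}=\sum_{k=1}^{\infty}a_k^{(j)}b^{-k},\qquad a_k^{(j)}\in\{0,1,\dots,b-1\},$$ be the base-$b$ digit expansion of $b_j/p$. It is purely periodic, and its least period has length $d$, so that $(a_1^{(j)},a_2^{(j)},\dots,a_d^{(j)})$ is its period. Let $$S_j=a_1^{(j)}+a_3^{(j)}+\dots+a_{d-1}^{(j)}$$ be the sum of the digits with odd indices in this period ($d$ is even). Then $$S_0+S_1+\dots+S_{\frac{p-1}{d}-1}=\frac{(b-1)(p-1)}{4}-\frac{(b+1)\,h_2^-}{2},$$ where $h_2^-$ is the class number of $\mathbb{Q}(\sqrt{-p})$. -/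

import Mathlib

/-- The representative `(k)_p` of the integer `k` modulo `p` in `{0, 1, …, p - 1}`. -/
def residueRep (p : ℕ) (k : ℤ) : ℤ := k % (p : ℤ)

/-- The digit `a_k`, `k ≥ 1`, of the base-`b` expansion `x = ∑_{k ≥ 1} a_k b^{-k}` of a real
number `x ∈ [0, 1)`. Mathlib's `Real.digits` numbers the digits from `0`. -/
noncomputable def expansionDigit (b : ℕ) [NeZero b] (x : ℝ) (k : ℕ) : ℕ :=
  (Real.digits x b (k - 1) : ℕ)

/-- The number `b_j / p`, where `b_j = (g^{2j})_p`. -/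
noncomputable def residueFraction (p : ℕ) (g : ℤ) (j : ℕ) : ℝ :=
  (residueRep p (g ^ (2 * j)) : ℝ) / (p : ℝ)

/-- `S_j = a_1 + a_3 + ⋯ + a_{d-1}`, the sum of the digits with odd indices among the first `d`
digits of the base-`b` expansion of `b_j / p`. -/
noncomputable def oddDigitSum (p b d : ℕ) [NeZero b] (g : ℤ) (j : ℕ) : ℕ :=
  ∑ k ∈ (Finset.Icc 1 d).filter Odd, expansionDigit b (residueFraction p g j) k

/-! Long division turns digits into residues: with `r_i` the residue of `x * b ^ i` in `[0, p)`, the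
digit `a_{i+1}` of `x / p` satisfies `p * a_{i+1} = b * r_i - r_{i+1}`
(`mul_expansionDigit_val_div`). Odd-indexed digits start from even powers of `b`. As `p - 1` is
twice an odd number and `d` is even, the elements `g^(2j) * b^(2i)` run once through the nonzero
squares (`sum_range_sum_range_eq_sum_isSquare`), and one more factor `b`, a nonresidue, carries
these onto the nonsquares. If `R` and `N` are the sums of the quadratic residues and nonresidues in
`(0, p)`, then `p` times the digit sum is `b * R - N`. Here `R + N = p * (p - 1) / 2`, so all that
remains is `R - N = -p * h`.

That is Dirichlet's class number formula (`sum_quadraticChar_mul_val_eq`), obtained from two values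
of `L(1, χ)`, `χ` being the Legendre symbol. Analytically, `L(1, χ)` is a cotangent sum, which the
Gauss sum `I * √p` converts into `-π / (p * √p) * ∑ χ(k) k`; the sign of the Gauss sum comes from
the theta function. Algebraically, counting ideals by norm gives `ζ_K = ζ * L(χ)`, so `L(1, χ)` is
the residue of `ζ_K` at `1`, which is `π * h / √p` since the field is imaginary quadratic of
discriminant `-p` with units `±1`. -/

/-! ### Digits, long division and sums over quadratic residues. -/

theorem residueFraction_eq_val_div (p : ℕ) [NeZero p] (g : ℤ) (j : ℕ) :
    residueFraction p g j = (((g : ZMod p) ^ (2 * j)).val : ℝ) / p := by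
  unfold residueFraction residueRep
  congr 1
  rw [← Int.cast_pow, ← ZMod.val_intCast, Int.cast_natCast]

/-- One step of the long division producing the base-`b` expansion of `x / p`. -/
theorem mul_expansionDigit_val_div (p : ℕ) [NeZero p] (b : ℕ) [NeZero b] (x : ZMod p) (i : ℕ) :
    (p : ℤ) * expansionDigit b ((x.val : ℝ) / p) (i + 1) =
      b * ((x * b ^ i).val : ℤ) - ((x * b ^ (i + 1)).val : ℤ) := by
  have hp : 0 < p := Nat.pos_of_ne_zero (NeZero.ne p)
  have hb : 0 < b := Nat.pos_of_ne_zero (NeZero.ne b)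
  have h1 : (x * b ^ i).val = (x.val * b ^ i) % p := by
    rw [← ZMod.val_natCast]; simp
  have h2 : (x * b ^ (i + 1)).val = (b * ((x.val * b ^ i) % p)) % p := by
    rw [← ZMod.val_natCast]; simp; ring_nf
  have h3 : expansionDigit b ((x.val : ℝ) / p) (i + 1) = (b * ((x.val * b ^ i) % p)) / p := by
    unfold expansionDigit Real.digits
    have : (x.val : ℝ) / p * (b : ℝ) ^ (i + 1 - 1 + 1) = ((x.val * b ^ (i + 1) : ℕ) : ℝ) / (p : ℕ) := by
      simp; ring
    rw [this, Nat.floor_div_eq_div]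
    simp only [Fin.val_ofNat]
    set N := x.val * b ^ i with hN
    have hM : x.val * b ^ (i + 1) = b * (N % p) + p * (b * (N / p)) := by
      have := Nat.mod_add_div N p
      calc x.val * b ^ (i + 1) = b * N := by rw [hN]; ring
        _ = b * (N % p + p * (N / p)) := by rw [this]
        _ = _ := by ring
    rw [hM, Nat.add_mul_div_left _ _ hp, Nat.add_mul_mod_self_left, Nat.mod_eq_of_lt]
    rw [Nat.div_lt_iff_lt_mul hp]
    exact Nat.mul_lt_mul_of_pos_left (Nat.mod_lt _ hp) hb
  rw [h1, h2, h3]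
  have := Nat.mod_add_div (b * (x.val * b ^ i % p)) p
  zify at this ⊢
  linarith

theorem isLeast_period_expansionDigit (p : ℕ) [Fact p.Prime] (b : ℕ) [NeZero b] (hb2 : 2 ≤ b)
    (hb : (b : ZMod p) ≠ 0) (x : ZMod p) (hx : x ≠ 0) :
    IsLeast {t : ℕ | 0 < t ∧ ∀ k ≥ 1, expansionDigit b ((x.val : ℝ) / p) (k + t) =
      expansionDigit b ((x.val : ℝ) / p) k} (orderOf (b : ZMod p)) := by
  have hp : (0 : ℤ) < p := by exact_mod_cast (Fact.out : p.Prime).pos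
  have hpow : (b : ZMod p) ^ (p - 1) = 1 := ZMod.pow_card_sub_one_eq_one hb
  refine ⟨⟨?_, ?_⟩, ?_⟩
  · exact orderOf_pos_iff.mpr (isOfFinOrder_iff_pow_eq_one.mpr
      ⟨p - 1, Nat.sub_pos_of_lt (Fact.out : p.Prime).one_lt, hpow⟩)
  · intro k hk
    obtain ⟨i, rfl⟩ := Nat.exists_eq_add_of_le' hk
    have h1 := mul_expansionDigit_val_div p b x i
    have h2 := mul_expansionDigit_val_div p b x (i + orderOf (b : ZMod p))
    rw [show i + orderOf (b : ZMod p) + 1 = (i + 1) + orderOf (b : ZMod p) by ring,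
      pow_add _ i, pow_add _ (i + 1), pow_orderOf_eq_one, mul_one, mul_one, ← h1] at h2
    exact_mod_cast mul_left_cancel₀ hp.ne' h2
  · rintro t ⟨ht, h⟩
    -- If `t` is a period of the digits, the difference of remainders `t` steps apart is multiplied
    -- by `b` at each step, yet stays below `p` in absolute value; hence it is zero.
    set e : ℕ → ℤ := fun i ↦ ((x * b ^ (i + t)).val : ℤ) - ((x * b ^ i).val : ℤ) with he
    have hstep : ∀ i, e (i + 1) = b * e i := fun i ↦ by
      have h1 := mul_expansionDigit_val_div p b x i
      have h2 := mul_expansionDigit_val_div p b x (i + t)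
      rw [show i + t + 1 = (i + 1) + t by ring, h (i + 1) (by omega), h1] at h2
      simp only [he]
      linarith
    have hpowe : ∀ i, e i = b ^ i * e 0 := fun i ↦ by
      induction i with
      | zero => simp
      | succ n ih => rw [hstep, ih]; ring
    have hbound : ∀ i, |e i| < p := fun i ↦ by
      have h1 := ZMod.val_lt (x * (b : ZMod p) ^ (i + t))
      have h2 := ZMod.val_lt (x * (b : ZMod p) ^ i)
      rw [abs_lt]
      constructor <;> simp only [he] <;> omega
    have he0 : e 0 = 0 := by
      by_contra hne
      have h1 := hbound p
      rw [hpowe, abs_mul, abs_pow, Nat.abs_cast] at h1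
      have h2 : (p : ℤ) < (b : ℤ) ^ p := by exact_mod_cast Nat.lt_pow_self hb2
      nlinarith [Int.one_le_abs hne]
    have h3 : x * (b : ZMod p) ^ t = x := by
      apply ZMod.val_injective
      simp only [he, zero_add, pow_zero, mul_one] at he0
      omega
    exact orderOf_le_of_pow_eq_one ht (mul_left_cancel₀ hx (by rw [h3, mul_one]))

theorem even_orderOf_of_not_isSquare {M : Type*} [Monoid M] {b : M} (hb : ¬ IsSquare b) :
    Even (orderOf b) := by
  by_contra h
  rw [Nat.not_even_iff_odd] at h
  obtain ⟨k, hk⟩ := h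
  refine hb ⟨b ^ (k + 1), ?_⟩
  rw [← pow_add, show k + 1 + (k + 1) = orderOf b + 1 by omega, pow_succ, pow_orderOf_eq_one, one_mul]

theorem sum_filter_odd_Icc {M : Type*} [AddCommMonoid M] (f : ℕ → M) (n : ℕ) :
    ∑ k ∈ (Finset.Icc 1 (2 * n)).filter Odd, f k = ∑ i ∈ Finset.range n, f (2 * i + 1) := by
  induction n with
  | zero => simp
  | succ n ih =>
    rw [Finset.sum_range_succ, ← ih, show 2 * (n + 1) = 2 * n + 1 + 1 by ring,
      ← Finset.insert_Icc_right_eq_Icc_add_one (by omega), ← Finset.insert_Icc_right_eq_Icc_add_one (by omega),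
      Finset.filter_insert, if_neg (by simp [parity_simps]), Finset.filter_insert,
      if_pos (by simp), Finset.sum_insert (by simp), add_comm]

/-- The powers of the square of a nonresidue, translated by the squares of a primitive root,
run once over the nonzero squares. -/
theorem sum_range_sum_range_eq_sum_isSquare {M : Type*} [AddCommMonoid M] (p : ℕ) [Fact p.Prime]
    (hp4 : p % 4 = 3) {b g : ZMod p} (hb : ¬ IsSquare b) (hg : IsPrimitiveRoot g (p - 1))
    (f : ZMod p → M) :
    ∑ j ∈ Finset.range ((p - 1) / orderOf b), ∑ i ∈ Finset.range (orderOf b / 2),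
      f (g ^ (2 * j) * b ^ (2 * i)) = ∑ x with x ≠ 0 ∧ IsSquare x, f x := by
  have hb0 : b ≠ 0 := by rintro rfl; exact hb (IsSquare.zero)
  have hg0 : g ≠ 0 := hg.ne_zero (by omega)
  have hdvd : orderOf b ∣ p - 1 := orderOf_dvd_of_pow_eq_one (ZMod.pow_card_sub_one_eq_one hb0)
  obtain ⟨c, hc⟩ := even_orderOf_of_not_isSquare hb
  obtain ⟨e, he⟩ := hdvd
  have hd0 : 0 < orderOf b := Nat.pos_of_ne_zero fun h ↦ by rw [h, zero_mul] at he; omega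
  have hediv : (p - 1) / orderOf b = e := by rw [he, Nat.mul_div_cancel_left _ hd0]
  have hcdiv : orderOf b / 2 = c := by omega
  -- `p - 1 = 2 * c * e` is congruent to 2 modulo 4.
  have heodd : Odd e := by
    rw [← Nat.not_even_iff_odd]
    rintro ⟨k, hk⟩
    have : p - 1 = 4 * (c * k) := by rw [he, hc, hk]; ring
    omega
  rw [hediv, hcdiv, ← Finset.sum_product']
  set F : ℕ × ℕ → ZMod p := fun q ↦ g ^ (2 * q.1) * b ^ (2 * q.2) with hF
  have hinj : Set.InjOn F (Finset.range e ×ˢ Finset.range c : Finset (ℕ × ℕ)) := by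
    rintro ⟨j, i⟩ hq ⟨j', i'⟩ hq' h
    simp only [Finset.coe_product, Finset.coe_range, Set.mem_prod, Set.mem_Iio] at hq hq'
    simp only [hF] at h
    -- Raising to the power `orderOf b` removes the powers of `b`; what is left determines `2 * j`
    -- modulo `e`, hence `j`, because `e` is odd.
    have h1 : g ^ (2 * j * orderOf b) = g ^ (2 * j' * orderOf b) := by
      have := congrArg (· ^ orderOf b) h
      simpa only [mul_pow, ← pow_mul, mul_comm _ (orderOf b), pow_mul b (orderOf b),
        pow_orderOf_eq_one, one_pow, mul_one] using this
    rw [(hg.isOfFinOrder (by omega)).pow_eq_pow_iff_modEq, ← hg.eq_orderOf, he,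
      mul_comm _ (orderOf b), mul_comm _ (orderOf b)] at h1
    have h2 : j ≡ j' [MOD e] := (Nat.ModEq.mul_left_cancel' hd0.ne' h1).cancel_left_of_coprime
      (by rw [Nat.gcd_comm]; exact (Nat.coprime_two_left.mpr heodd))
    obtain rfl : j = j' := h2.eq_of_lt_of_lt hq.1 hq'.1
    have h3 := pow_injOn_Iio_orderOf (x := b) (by simp; omega) (by simp; omega)
      (mul_left_cancel₀ (pow_ne_zero _ hg0) h)
    simp only [Prod.mk.injEq, true_and]
    omega
  have hsub : (Finset.range e ×ˢ Finset.range c).image F ⊆ ({x | x ≠ 0 ∧ IsSquare x} : Finset _) := by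
    intro x hx
    obtain ⟨q, -, rfl⟩ := Finset.mem_image.mp hx
    simp only [Finset.mem_filter, Finset.mem_univ, true_and, hF]
    exact ⟨mul_ne_zero (pow_ne_zero _ hg0) (pow_ne_zero _ hb0), g ^ q.1 * b ^ q.2, by ring⟩
  -- There are at most `e * c` nonzero squares, so the injective family `F` of `e * c` squares
  -- exhausts them.
  have hsq : ({x | x ≠ 0 ∧ IsSquare x} : Finset (ZMod p)) ⊆
      (Finset.range (e * c)).image fun i ↦ g ^ (2 * i) := by
    intro x hx
    simp only [Finset.mem_filter, Finset.mem_univ, true_and] at hx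
    obtain ⟨hx0, y, rfl⟩ := hx
    have hy0 : y ≠ 0 := left_ne_zero_of_mul hx0
    have : NeZero (p - 1) := ⟨by omega⟩
    obtain ⟨k, -, rfl⟩ := hg.eq_pow_of_pow_eq_one (ZMod.pow_card_sub_one_eq_one hy0)
    have hec : 0 < e * c := by
      refine Nat.mul_pos heodd.pos (by omega)
    refine Finset.mem_image.mpr ⟨k % (e * c), Finset.mem_range.mpr (Nat.mod_lt _ hec), ?_⟩
    rw [← pow_add, (hg.isOfFinOrder (by omega)).pow_eq_pow_iff_modEq, ← hg.eq_orderOf, ← two_mul,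
      show p - 1 = 2 * (e * c) by rw [he, hc]; ring]
    exact Nat.ModEq.mul_left' 2 (Nat.mod_modEq _ _)
  have himage : (Finset.range e ×ˢ Finset.range c).image F = ({x | x ≠ 0 ∧ IsSquare x} : Finset _) := by
    refine Finset.eq_of_subset_of_card_le hsub ((Finset.card_le_card hsq).trans ?_)
    rw [Finset.card_image_of_injOn hinj, Finset.card_product, Finset.card_range, Finset.card_range]
    exact Finset.card_image_le.trans (by simp)
  rw [← himage, Finset.sum_image hinj]

/-- Away from 0, `1 + χ` is twice the indicator of the squares; at 0 it equals 1, whence the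
condition on `f 0`. -/
theorem two_mul_sum_isSquare (p : ℕ) [Fact p.Prime] (f : ZMod p → ℤ) (hf : f 0 = 0) :
    2 * ∑ x with x ≠ 0 ∧ IsSquare x, f x = ∑ x, (1 + quadraticChar (ZMod p) x) * f x := by
  rw [Finset.sum_filter, Finset.mul_sum]
  refine Finset.sum_congr rfl fun x _ ↦ ?_
  by_cases hx : x = 0
  · simp [hx, hf]
  by_cases hs : IsSquare x
  · rw [if_pos ⟨hx, hs⟩, (quadraticChar_one_iff_isSquare hx).mpr hs]; ring
  · rw [if_neg (by tauto), quadraticChar_neg_one_iff_not_isSquare.mpr hs]; ring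

theorem two_mul_sum_val (p : ℕ) [NeZero p] : 2 * ∑ x : ZMod p, (x.val : ℤ) = p * (p - 1) := by
  obtain ⟨n, rfl⟩ := Nat.exists_eq_succ_of_ne_zero (NeZero.ne p)
  have h : ∑ x : ZMod (n + 1), (x.val : ℤ) = ∑ i ∈ Finset.range (n + 1), (i : ℤ) :=
    Fin.sum_univ_eq_sum_range (fun i ↦ (i : ℤ)) (n + 1)
  have := Finset.sum_range_id_mul_two (n + 1)
  rw [h]
  zify at this
  rw [add_tsub_cancel_right] at this
  push_cast at this ⊢
  linarith

theorem sum_oddDigitSum_eq (p : ℕ) [Fact p.Prime] (hp4 : p % 4 = 3)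
    (b : ℕ) [NeZero b] (hb : ¬ IsSquare (b : ZMod p))
    (g : ℤ) (hg : IsPrimitiveRoot (g : ZMod p) (p - 1)) (h : ℤ)
    (hh : ∑ x : ZMod p, quadraticChar (ZMod p) x * x.val = -(p * h)) :
    ((∑ j ∈ Finset.range ((p - 1) / orderOf (b : ZMod p)),
      oddDigitSum p b (orderOf (b : ZMod p)) g j : ℕ) : ℚ) =
      ((b : ℚ) - 1) * ((p : ℚ) - 1) / 4 - ((b : ℚ) + 1) * (h : ℚ) / 2 := by
  have hb0 : (b : ZMod p) ≠ 0 := by intro h; exact hb (h ▸ IsSquare.zero)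
  obtain ⟨c, hc⟩ := even_orderOf_of_not_isSquare hb
  have hpS : (p : ℤ) * ((∑ j ∈ Finset.range ((p - 1) / orderOf (b : ZMod p)),
      oddDigitSum p b (orderOf (b : ZMod p)) g j : ℕ) : ℤ) =
      ∑ x : ZMod p with x ≠ 0 ∧ IsSquare x, ((b : ℤ) * x.val - (x * b).val) := by
    rw [← sum_range_sum_range_eq_sum_isSquare p hp4 hb hg, Nat.cast_sum, Finset.mul_sum]
    refine Finset.sum_congr rfl fun j _ ↦ ?_
    rw [oddDigitSum, Nat.cast_sum, show orderOf (b : ZMod p) = 2 * c by omega, sum_filter_odd_Icc,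
      Finset.mul_sum, Nat.mul_div_cancel_left _ two_pos]
    refine Finset.sum_congr rfl fun i _ ↦ ?_
    rw [residueFraction_eq_val_div, mul_expansionDigit_val_div, pow_succ, ← mul_assoc]
  -- Substituting `x * b` for `x` flips the sign of the character, as `b` is a nonresidue.
  have h1 : ∑ x : ZMod p, (1 + quadraticChar (ZMod p) x) * ((x * b).val : ℤ) =
      ∑ x : ZMod p, (1 - quadraticChar (ZMod p) x) * (x.val : ℤ) := by
    refine Fintype.sum_equiv (Equiv.mulRight₀ (b : ZMod p) hb0) _ _ fun x ↦ ?_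
    simp only [Equiv.mulRight₀, Units.mulRight_apply, Units.val_mk0]
    rw [map_mul, quadraticChar_neg_one_iff_not_isSquare.mpr hb]
    ring
  have h2 := two_mul_sum_isSquare p (fun x ↦ (b : ℤ) * x.val - (x * b).val) (by simp)
  rw [← hpS] at h2
  simp only [mul_sub] at h2
  rw [Finset.sum_sub_distrib, h1] at h2
  have h3 : ∑ x : ZMod p, (1 + quadraticChar (ZMod p) x) * ((b : ℤ) * x.val) =
      b * (∑ x : ZMod p, (x.val : ℤ) + ∑ x, quadraticChar (ZMod p) x * x.val) := by
    rw [← Finset.sum_add_distrib, Finset.mul_sum]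
    exact Finset.sum_congr rfl fun x _ ↦ by ring
  have h4 : ∑ x : ZMod p, (1 - quadraticChar (ZMod p) x) * (x.val : ℤ) =
      ∑ x : ZMod p, (x.val : ℤ) - ∑ x, quadraticChar (ZMod p) x * x.val := by
    rw [← Finset.sum_sub_distrib]
    exact Finset.sum_congr rfl fun x _ ↦ by ring
  have h5 := two_mul_sum_val p
  rw [h3, h4, hh] at h2
  have hp0 : (p : ℚ) ≠ 0 := by exact_mod_cast (Fact.out : p.Prime).ne_zero
  set T := ∑ j ∈ Finset.range ((p - 1) / orderOf (b : ZMod p)),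
      oddDigitSum p b (orderOf (b : ZMod p)) g j
  set V := ∑ x : ZMod p, (x.val : ℤ)
  have h2' : (2 : ℚ) * (p * T) = b * (V + -(p * h)) - (V - -(p * h)) := by exact_mod_cast h2
  have h5' : (2 : ℚ) * V = p * (p - 1) := by exact_mod_cast h5
  apply mul_left_cancel₀ hp0
  linear_combination h2' / 2 + (b - 1) / 4 * h5'

/-! ### The sign of the quadratic Gauss sum, by theta asymptotics. -/

open Filter Topology Complex in
theorem summable_exp_neg_pi_mul_int_sq {ε : ℂ} (hε : 0 < ε.re) :
    Summable fun n : ℤ ↦ cexp (-Real.pi * ε * n ^ 2) := by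
  have h := (hasSum_jacobiTheta₂_term 0 (τ := I * ε) (by simpa using hε)).summable
  refine h.congr fun n ↦ ?_
  rw [jacobiTheta₂_term]
  congr 1
  linear_combination (Real.pi * n ^ 2 * ε) * I_sq

theorem Complex.ofReal_mul_cpow {r : ℝ} (hr : 0 < r) {z : ℂ} (hz : z ≠ 0) (s : ℂ) :
    ((r : ℂ) * z) ^ s = (r : ℂ) ^ s * z ^ s := by
  have hr' : (r : ℂ) ≠ 0 := Complex.ofReal_ne_zero.mpr hr.ne'
  rw [Complex.cpow_def_of_ne_zero (mul_ne_zero hr' hz), Complex.cpow_def_of_ne_zero hr',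
    Complex.cpow_def_of_ne_zero hz, Complex.log_ofReal_mul hr hz, ← Complex.ofReal_log hr.le,
    add_mul, Complex.exp_add]

theorem Int.tsum_eq_sum_residueClasses {N : ℕ} [NeZero N] {G : ℤ → ℂ} (hG : Summable G) :
    ∑' n, G n = ∑ a : Fin N, ∑' k : ℤ, G (k * N + (a : ℕ)) := by
  have hG' : Summable (G ∘ (Int.divModEquiv N).symm) := (Equiv.summable_iff _).mpr hG
  rw [← (Int.divModEquiv N).symm.tsum_eq G, ← tsum_fintype (L := .unconditional _)]
  have h2 : Summable fun q : Fin N × ℤ ↦ (G ∘ (Int.divModEquiv N).symm) q.swap := hG'.prod_symm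
  rw [← (Equiv.prodComm (Fin N) ℤ).tsum_eq]
  rw [Summable.tsum_prod (by exact h2)]
  simp [Int.divModEquiv]

open Filter Topology Complex in
-- Poisson summation gives a sum of terms of absolute value `exp (-π n² Re(1/ε) / N²)`, of which
-- only `n = 0` survives in the limit. Complex `ε` is allowed because the application approaches 0
-- along a curve off the real axis.
theorem tendsto_tsum_exp_residueClass {ι : Type*} {l : Filter ι} [l.IsCountablyGenerated]
    {ε : ι → ℂ} (hε : ∀ᶠ i in l, 0 < (ε i).re)
    (hε' : Tendsto (fun i ↦ (1 / ε i).re) l atTop) (N : ℕ) [NeZero N] (a : ℕ) :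
    Tendsto (fun i ↦ N * (ε i) ^ (1 / 2 : ℂ) * ∑' k : ℤ, cexp (-Real.pi * ε i * (k * N + a) ^ 2))
      l (𝓝 1) := by
  have hN : (0 : ℝ) < N := by exact_mod_cast Nat.pos_of_ne_zero (NeZero.ne N)
  have hNc : (N : ℂ) ≠ 0 := by exact_mod_cast hN.ne'
  have key : ∀ᶠ i in l, ∑' n : ℤ, cexp (-Real.pi / N ^ 2 * (1 / ε i) * n ^ 2 + 2 * Real.pi * I * n * a / N) =
      N * (ε i) ^ (1 / 2 : ℂ) * ∑' k : ℤ, cexp (-Real.pi * ε i * (k * N + a) ^ 2) := by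
    filter_upwards [hε] with i hi
    set e := ε i
    have he : e ≠ 0 := by rintro h; simp [h] at hi
    -- Expanding `ε (kN + a)²` gives quadratic coefficient `N² ε` and linear coefficient `2 ε N a`.
    have h1 := Complex.tsum_exp_neg_quadratic (a := ((N ^ 2 : ℝ) : ℂ) * e) (by
      rw [re_ofReal_mul]; positivity) (-e * N * a)
    have hsqrt : ((N ^ 2 : ℝ) : ℂ) ^ (1 / 2 : ℂ) = N := by
      have := Complex.sq_cpow_two_inv (x := N) (by simpa using hN)
      rw [ofReal_pow, ofReal_natCast, one_div, this]
    rw [Complex.ofReal_mul_cpow (by positivity) he, hsqrt] at h1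
    have hs : e ^ (1 / 2 : ℂ) ≠ 0 := by simp [cpow_eq_zero_iff, he]
    calc _ = cexp (-Real.pi * e * a ^ 2) * ∑' n : ℤ, cexp (-Real.pi / (((N ^ 2 : ℝ) : ℂ) * e) * (n + I * (-e * N * a)) ^ 2) := by
          rw [← tsum_mul_left]
          refine tsum_congr fun n ↦ ?_
          rw [← Complex.exp_add]
          congr 1
          push_cast
          field_simp
          linear_combination (a ^ 2 * e ^ 2 * N ^ 2) * I_sq
      _ = N * e ^ (1 / 2 : ℂ) * (cexp (-Real.pi * e * a ^ 2) *
            ∑' n : ℤ, cexp (-Real.pi * (((N ^ 2 : ℝ) : ℂ) * e) * n ^ 2 + 2 * Real.pi * (-e * N * a) * n)) := by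
          rw [h1]; field_simp
      _ = _ := by
          rw [← tsum_mul_left (a := cexp _)]
          congr 1
          refine tsum_congr fun n ↦ ?_
          rw [← Complex.exp_add]
          congr 1
          push_cast
          ring
  have hnorm : ∀ i (n : ℤ), ‖cexp (-Real.pi / N ^ 2 * (1 / ε i) * n ^ 2 + 2 * Real.pi * I * n * a / N)‖ =
      Real.exp (-(Real.pi / N ^ 2 * n ^ 2) * (1 / ε i).re) := fun i n ↦ by
    rw [norm_exp]
    congr 1
    rw [show -(Real.pi : ℂ) / N ^ 2 * (1 / ε i) * n ^ 2 + 2 * Real.pi * I * n * a / N =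
      ((-(Real.pi / N ^ 2 * n ^ 2) : ℝ) : ℂ) * (1 / ε i) + ((2 * Real.pi * n * a / N : ℝ) : ℂ) * I by
        push_cast; ring]
    rw [add_re, re_ofReal_mul, re_ofReal_mul, I_re, mul_zero, add_zero]
  refine Tendsto.congr' key ?_
  have hlim : ∑' n : ℤ, (if n = 0 then (1 : ℂ) else 0) = 1 := by simp
  suffices h : Tendsto (fun i ↦ ∑' n : ℤ, cexp (-Real.pi / N ^ 2 * (1 / ε i) * n ^ 2 +
      2 * Real.pi * I * n * a / N)) l (𝓝 (∑' n : ℤ, if n = 0 then (1 : ℂ) else 0)) by rwa [hlim] at h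
  refine tendsto_tsum_of_dominated_convergence (bound := fun n : ℤ ↦ Real.exp (-(Real.pi / N ^ 2 * n ^ 2))) ?_ ?_ ?_
  · have := (summable_exp_neg_pi_mul_int_sq (ε := ((1 / N ^ 2 : ℝ) : ℂ)) (by rw [ofReal_re]; positivity)).norm
    refine this.congr fun n ↦ ?_
    rw [norm_exp, show -(Real.pi : ℂ) * ((1 / N ^ 2 : ℝ) : ℂ) * n ^ 2 =
      ((-(Real.pi / N ^ 2 * n ^ 2) : ℝ) : ℂ) by push_cast; ring, ofReal_re]
  · intro n
    by_cases hn : n = 0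
    · simpa [hn] using tendsto_const_nhds
    · rw [if_neg hn, tendsto_zero_iff_norm_tendsto_zero]
      simp only [hnorm]
      refine Real.tendsto_exp_atBot.comp (hε'.const_mul_atTop_of_neg ?_)
      have : (0 : ℝ) < (n : ℝ) ^ 2 := by positivity
      have := Real.pi_pos
      rw [neg_lt_zero]
      positivity
  · filter_upwards [hε'.eventually_ge_atTop 1] with i hi n
    rw [hnorm]
    refine Real.exp_le_exp.mpr ?_
    have : 0 ≤ Real.pi / N ^ 2 * (n : ℝ) ^ 2 := by have := Real.pi_pos; positivity
    nlinarith

open Filter Topology Complex in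
-- Each residue class modulo `N` contributes equally to the leading term, so a periodic weight
-- enters only through its mean.
theorem tendsto_cpow_mul_tsum_periodic_mul_exp {ι : Type*} {l : Filter ι} [l.IsCountablyGenerated]
    {ε : ι → ℂ} (hε : ∀ᶠ i in l, 0 < (ε i).re)
    (hε' : Tendsto (fun i ↦ (1 / ε i).re) l atTop) (N : ℕ) [NeZero N] (f : ℤ → ℂ)
    (hf : ∀ n : ℤ, f (n + N) = f n) (hf1 : ∀ n, ‖f n‖ ≤ 1) :
    Tendsto (fun i ↦ (ε i) ^ (1 / 2 : ℂ) * ∑' n : ℤ, f n * cexp (-Real.pi * ε i * n ^ 2)) l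
      (𝓝 ((∑ a : Fin N, f (a : ℕ)) / N)) := by
  have hNc : (N : ℂ) ≠ 0 := by exact_mod_cast NeZero.ne N
  have hper : ∀ (k n : ℤ), f (k * N + n) = f n := fun k n ↦ by
    have := (show Function.Periodic f (N : ℤ) from hf).int_mul k n
    rwa [add_comm] at this
  have key : ∀ᶠ i in l, ∑ a : Fin N, f (a : ℕ) / N * (N * (ε i) ^ (1 / 2 : ℂ) *
      ∑' k : ℤ, cexp (-Real.pi * ε i * (k * N + (a : ℕ)) ^ 2)) =
      (ε i) ^ (1 / 2 : ℂ) * ∑' n : ℤ, f n * cexp (-Real.pi * ε i * n ^ 2) := by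
    filter_upwards [hε] with i hi
    have hs : Summable fun n : ℤ ↦ f n * cexp (-Real.pi * ε i * n ^ 2) := by
      refine Summable.of_norm_bounded (summable_exp_neg_pi_mul_int_sq hi).norm fun n ↦ ?_
      rw [norm_mul]
      exact mul_le_of_le_one_left (norm_nonneg _) (hf1 n)
    rw [Int.tsum_eq_sum_residueClasses (N := N) hs, Finset.mul_sum]
    refine Finset.sum_congr rfl fun a _ ↦ ?_
    simp only [hper, tsum_mul_left]
    push_cast
    field_simp
  refine Tendsto.congr' key ?_
  rw [Finset.sum_div]
  refine tendsto_finsetSum _ fun a _ ↦ ?_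
  simpa using (tendsto_tsum_exp_residueClass hε hε' N a).const_mul (f (a : ℕ) / N)

open Filter Topology Complex in
-- The Landsberg–Schaar argument: compare both sides of `θ(A) = A^(-1/2) θ(1/A)` as `1/A = η + I p /
-- 2` approaches `I p / 2`. The left side is governed by the Gauss sum modulo `p`, the right side by
-- a two-term sum modulo 2, which equals `1 + I` when `p % 4 = 3`.
theorem sum_exp_sq_div_eq (p : ℕ) [NeZero p] (hp4 : p % 4 = 3) :
    ∑ a : Fin p, cexp (2 * Real.pi * I * ((a : ℕ) : ℂ) ^ 2 / p) = I * ((√p : ℝ) : ℂ) := by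
  have hp : (0 : ℝ) < p := by exact_mod_cast Nat.pos_of_ne_zero (NeZero.ne p)
  have hpc : (p : ℂ) ≠ 0 := by exact_mod_cast hp.ne'
  set l : Filter ℝ := 𝓝[>] 0
  set A : ℝ → ℂ := fun η ↦ 1 / (η + I * p / 2) with hA
  -- This is `A + 2 I / p`, the distance of `A` from its limit. Factoring out the positive real `η`
  -- lets the square root be split without branch trouble, and the other factor tends to `(2 / p)²`.
  set ε : ℝ → ℂ := fun η ↦ η * (2 * I / p * A η) with hε
  have hne : ∀ η > (0 : ℝ), (η + I * p / 2 : ℂ) ≠ 0 := fun η hη h ↦ by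
    have := congrArg re h
    simp at this
    linarith
  have hpos : ∀ᶠ η in l, (0 : ℝ) < η := self_mem_nhdsWithin
  have hAre : ∀ η > (0 : ℝ), 0 < (A η).re := fun η hη ↦ by
    simp only [hA, one_div, inv_re]
    have := normSq_pos.mpr (hne η hη)
    refine div_pos ?_ this
    simpa using hη
  have hεA : ∀ η > (0 : ℝ), ε η = A η + 2 * I / p := fun η hη ↦ by
    have h1 : (η + I * p / 2 : ℂ) * A η = 1 := mul_one_div_cancel (hne η hη)
    have h2 : 2 * I / p * (I * p / 2) = -1 := by field_simp; exact I_sq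
    simp only [hε]
    linear_combination (2 * I / p) * h1 - A η * h2
  have hεre : ∀ᶠ η in l, 0 < (ε η).re := by
    filter_upwards [hpos] with η hη
    have : (2 * I / p : ℂ).re = 0 := by
      rw [show (2 * I / p : ℂ) = ((2 / p : ℝ) : ℂ) * I by push_cast; ring]
      simp
    rw [hεA η hη, add_re, this, add_zero]
    exact hAre η hη
  have hεinv : Tendsto (fun η ↦ (1 / ε η).re) l atTop := by
    have h1 : Tendsto (fun η : ℝ ↦ (p : ℝ) ^ 2 / 4 * η⁻¹) l atTop :=
      tendsto_inv_nhdsGT_zero.const_mul_atTop (by positivity)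
    refine h1.congr' ?_
    filter_upwards [hpos] with η hη
    have hη' : (η : ℂ) ≠ 0 := ofReal_ne_zero.mpr hη.ne'
    have : 1 / ε η = ((p ^ 2 / 4 * η⁻¹ : ℝ) : ℂ) + ((-(p / 2) : ℝ) : ℂ) * I := by
      have h3 := hne η hη
      have h4 : ε η = η * (2 * I / p * (1 / (η + I * p / 2))) := rfl
      have h5 : ε η ≠ 0 := by
        rw [h4]
        exact mul_ne_zero hη' (mul_ne_zero (div_ne_zero (by simp) hpc) (one_div_ne_zero h3))
      rw [div_eq_iff h5, h4]
      push_cast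
      generalize hB : (η + I * p / 2 : ℂ) = B at h3
      have h6 : (η : ℂ) = B - I * p / 2 := by rw [← hB]; ring
      field_simp
      rw [h6]
      have hI3 : I ^ 3 = -I := by rw [pow_succ, I_sq]; ring
      ring_nf
      simp only [I_sq, hI3]
      ring
    rw [this, add_re, ofReal_re, re_ofReal_mul, I_re, mul_zero, add_zero]
  have hηinv : Tendsto (fun η : ℝ ↦ (1 / (η : ℂ)).re) l atTop := by
    refine tendsto_inv_nhdsGT_zero.congr fun η ↦ ?_
    rw [← ofReal_one, ← ofReal_div, ofReal_re, one_div]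
  have hηre : ∀ᶠ η : ℝ in l, 0 < ((η : ℂ)).re := by simpa using hpos
  have hL := tendsto_cpow_mul_tsum_periodic_mul_exp hεre hεinv p
    (fun n : ℤ ↦ cexp (2 * Real.pi * I * (n : ℂ) ^ 2 / p)) (fun n ↦ by
      rw [Complex.exp_eq_exp_iff_exists_int]
      refine ⟨2 * n + p, ?_⟩
      push_cast
      field_simp
      ring) (fun n ↦ by
      rw [show 2 * Real.pi * I * (n : ℂ) ^ 2 / p = ((2 * Real.pi * n ^ 2 / p : ℝ) : ℂ) * I by
        push_cast; ring, norm_exp_ofReal_mul_I])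
  have hR := tendsto_cpow_mul_tsum_periodic_mul_exp hηre hηinv 2
    (fun n : ℤ ↦ cexp (-Real.pi * I * p * (n : ℂ) ^ 2 / 2)) (fun n ↦ by
      rw [Complex.exp_eq_exp_iff_exists_int]
      refine ⟨-(p * (n + 1)), ?_⟩
      push_cast
      ring) (fun n ↦ by
      rw [show -Real.pi * I * p * (n : ℂ) ^ 2 / 2 = ((-(Real.pi * p * n ^ 2 / 2) : ℝ) : ℂ) * I by
        push_cast; ring, norm_exp_ofReal_mul_I])
  have hval : (∑ a : Fin 2, cexp (-Real.pi * I * p * (((a : ℕ) : ℤ) : ℂ) ^ 2 / 2)) / (2 : ℕ) =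
      (1 + I) / 2 := by
    have : cexp (-(Real.pi * I * p) / 2) = I := by
      obtain ⟨k, hk⟩ : ∃ k, p = 4 * k + 3 := ⟨p / 4, by omega⟩
      refine Eq.trans ?_ exp_pi_div_two_mul_I
      rw [Complex.exp_eq_exp_iff_exists_int]
      refine ⟨-(k + 1), ?_⟩
      rw [hk]
      push_cast
      ring
    simp [Fin.sum_univ_two, this]
  rw [hval] at hR
  have hAlim : Tendsto A l (𝓝 (-(2 * I / p))) := by
    have h1 : Tendsto (fun η : ℝ ↦ (η : ℂ) + I * p / 2) l (𝓝 ((0 : ℝ) + I * p / 2)) :=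
      ((continuous_ofReal.tendsto 0).mono_left nhdsWithin_le_nhds).add_const _
    have h2 : ((0 : ℝ) : ℂ) + I * p / 2 ≠ 0 := by simp [hpc]
    have h3 := h1.inv₀ h2
    simp only [hA, one_div]
    convert h3 using 2
    rw [ofReal_zero, zero_add]
    field_simp
    rw [I_sq]
    norm_num
  -- The square root of `lim A = -2 I / p` with positive real part, hence the principal one.
  set w : ℂ := (1 - I) / ((√p : ℝ) : ℂ) with hw
  have hsp : (((√p : ℝ) : ℂ)) ^ 2 = p := by
    rw [← ofReal_pow, Real.sq_sqrt hp.le, ofReal_natCast]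
  have hsp0 : ((√p : ℝ) : ℂ) ≠ 0 := by
    rw [ofReal_ne_zero]; exact (Real.sqrt_pos.mpr hp).ne'
  have hwre : 0 < w.re := by
    rw [hw, show (1 - I) / ((√p : ℝ) : ℂ) = ((1 / √p : ℝ) : ℂ) * (1 - I) by push_cast; ring, re_ofReal_mul]
    have := Real.sqrt_pos.mpr hp
    simp only [sub_re, one_re, I_re, sub_zero, mul_one]
    positivity
  have hw2 : w ^ 2 = -(2 * I / p) := by
    rw [hw, div_pow, hsp, sub_sq, I_sq]
    ring
  have hA12 : Tendsto (fun η ↦ A η ^ (1 / 2 : ℂ)) l (𝓝 w) := by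
    have h1 : -(2 * I / p : ℂ) ∈ slitPlane := by
      rw [mem_slitPlane_iff]
      right
      rw [show -(2 * I / p : ℂ) = ((-(2 / p) : ℝ) : ℂ) * I by push_cast; ring, im_ofReal_mul, I_im,
        mul_one]
      have : (0 : ℝ) < 2 / p := by positivity
      linarith
    have h2 := hAlim.cpow (tendsto_const_nhds (x := (1 / 2 : ℂ))) h1
    rw [← hw2, one_div, sq_cpow_two_inv hwre] at h2
    simpa only [one_div] using h2
  have hB12 : Tendsto (fun η ↦ (2 * I / p * A η) ^ (1 / 2 : ℂ)) l (𝓝 (2 / p)) := by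
    have h0 : (2 * I / p * -(2 * I / p) : ℂ) = (2 / p) ^ 2 := by
      field_simp
      rw [I_sq]; ring
    have h1 := hAlim.const_mul (2 * I / p : ℂ)
    rw [h0] at h1
    have h3 : ((2 / p : ℂ)) = ((2 / p : ℝ) : ℂ) := by push_cast; rfl
    have h2 := h1.cpow (tendsto_const_nhds (x := (1 / 2 : ℂ))) (by
      rw [h3, ← ofReal_pow, ofReal_mem_slitPlane]; positivity)
    rw [one_div, sq_cpow_two_inv (by rw [h3, ofReal_re]; positivity)] at h2
    simpa only [one_div] using h2
  have hw0 : w ≠ 0 := by rintro h; simp [h] at hwre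
  have hlim2 := (hB12.mul (hA12.inv₀ hw0)).mul hR
  have hEq : ∀ᶠ η : ℝ in l, ((2 * I / p * A η) ^ (1 / 2 : ℂ) * (A η ^ (1 / 2 : ℂ))⁻¹) *
      ((η : ℂ) ^ (1 / 2 : ℂ) * ∑' n : ℤ, cexp (-Real.pi * I * p * (n : ℂ) ^ 2 / 2) *
        cexp (-Real.pi * η * n ^ 2)) =
      (ε η) ^ (1 / 2 : ℂ) * ∑' n : ℤ, cexp (2 * Real.pi * I * (n : ℂ) ^ 2 / p) *
        cexp (-Real.pi * ε η * n ^ 2) := by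
    filter_upwards [hpos] with η hη
    have hA0 : A η ≠ 0 := one_div_ne_zero (hne η hη)
    have h1 : ε η ^ (1 / 2 : ℂ) = (η : ℂ) ^ (1 / 2 : ℂ) * (2 * I / p * A η) ^ (1 / 2 : ℂ) :=
      Complex.ofReal_mul_cpow hη (mul_ne_zero (div_ne_zero (by simp) hpc) hA0) _
    have h2 : ∑' n : ℤ, cexp (2 * Real.pi * I * (n : ℂ) ^ 2 / p) * cexp (-Real.pi * ε η * n ^ 2) =
        ∑' n : ℤ, cexp (-Real.pi * A η * n ^ 2) := by
      refine tsum_congr fun n ↦ ?_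
      rw [← Complex.exp_add, hεA η hη]
      congr 1
      ring
    have h3 : ∑' n : ℤ, cexp (-Real.pi * I * p * (n : ℂ) ^ 2 / 2) * cexp (-Real.pi * η * n ^ 2) =
        ∑' n : ℤ, cexp (-Real.pi / A η * n ^ 2) := by
      refine tsum_congr fun n ↦ ?_
      rw [← Complex.exp_add]
      congr 1
      simp only [hA, div_div_eq_mul_div, div_one]
      ring
    rw [h1, h2, h3, Complex.tsum_exp_neg_mul_int_sq (hAre η hη)]
    ring
  have hfin := tendsto_nhds_unique (hL.congr' (hEq.mono fun _ h ↦ h.symm)) hlim2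
  simp only [Int.cast_natCast] at hfin
  rw [div_eq_iff hpc] at hfin
  rw [hfin, hw]
  have h1I : (1 - I : ℂ) ≠ 0 := by
    intro h
    have := congrArg re h
    simp at this
  field_simp
  linear_combination I_sq

/-! ### The odd Hurwitz zeta function at 1. -/

/-- The difference gains a factor `1 / n` over each term. Uniformity in `s` makes this a dominating
series as `s` decreases to 1. -/
theorem abs_rpow_neg_sub_rpow_neg_le {x : ℝ} (hx0 : 0 < x) (hx1 : x < 1) {n : ℕ} (hn : 1 ≤ n)
    {s : ℝ} (hs1 : 1 ≤ s) (hs2 : s ≤ 2) :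
    |((n : ℝ) + x) ^ (-s) - ((n : ℝ) - x) ^ (-s)| ≤
      (1 / (1 - x) + 1 / (1 - x) ^ 2) * 4 * (1 / (n : ℝ) ^ 2) := by
  have hn' : (1 : ℝ) ≤ n := by exact_mod_cast hn
  have hn0 : (0 : ℝ) < n := by linarith
  set A : ℝ := n + x with hA
  set B : ℝ := n - x with hB
  have hA0 : 0 < A := by linarith
  have hB0 : 0 < B := by linarith
  have hx' : 0 < 1 - x := by linarith
  have hBn : (1 - x) * n ≤ B := by nlinarith
  have h1 : A ^ (-s) = B ^ (-s) * (B / A) ^ s := by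
    rw [Real.div_rpow hB0.le hA0.le, Real.rpow_neg hA0.le, Real.rpow_neg hB0.le]
    have := (Real.rpow_pos_of_pos hB0 s).ne'
    field_simp
  have hBA : B / A ≤ 1 := by rw [div_le_one hA0]; linarith
  have h2 : (B / A) ^ 2 ≤ (B / A) ^ s := by
    rw [← Real.rpow_two]
    exact Real.rpow_le_rpow_of_exponent_ge (by positivity) hBA hs2
  have h3 : (B / A) ^ s ≤ 1 := Real.rpow_le_one (by positivity) hBA (by linarith)
  -- `B` may lie on either side of 1 (when `n = 1`), so both extreme exponents are kept.
  have h4 : B ^ (-s) ≤ 1 / B + 1 / B ^ 2 := by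
    have e1 : B ^ (-1 : ℝ) = 1 / B := by rw [Real.rpow_neg_one, one_div]
    have e2 : B ^ (-2 : ℝ) = 1 / B ^ 2 := by rw [Real.rpow_neg hB0.le, Real.rpow_two, one_div]
    rcases le_total B 1 with h | h
    · have := Real.rpow_le_rpow_of_exponent_ge hB0 h (show (-2 : ℝ) ≤ -s by linarith)
      have : 0 ≤ 1 / B := by positivity
      linarith
    · have := Real.rpow_le_rpow_of_exponent_le h (show -s ≤ (-1 : ℝ) by linarith)
      have : 0 ≤ 1 / B ^ 2 := by positivity
      linarith
  have h5 : 1 - (B / A) ^ 2 ≤ 4 / n := by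
    have : 1 - (B / A) ^ 2 = 4 * n * x / A ^ 2 := by
      field_simp; rw [hA, hB]; ring
    rw [this, div_le_div_iff₀ (by positivity) hn0]
    have : (n : ℝ) * n ≤ A ^ 2 := by rw [hA]; nlinarith
    nlinarith
  have h6 : 1 / B + 1 / B ^ 2 ≤ (1 / (1 - x) + 1 / (1 - x) ^ 2) * (1 / n) := by
    have e1 : 1 / B ≤ 1 / ((1 - x) * n) := one_div_le_one_div_of_le (by positivity) hBn
    have e2 : 1 / B ^ 2 ≤ 1 / ((1 - x) ^ 2 * n) := by
      refine one_div_le_one_div_of_le (by positivity) ?_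
      have : ((1 - x) * n) ^ 2 ≤ B ^ 2 := pow_le_pow_left₀ (by positivity) hBn 2
      nlinarith [mul_nonneg (sq_nonneg (1 - x)) (mul_nonneg hn0.le (sub_nonneg.mpr hn'))]
    calc _ ≤ 1 / ((1 - x) * n) + 1 / ((1 - x) ^ 2 * n) := add_le_add e1 e2
      _ = _ := by field_simp
  have h7 : 0 < B ^ (-s) := Real.rpow_pos_of_pos hB0 _
  rw [h1, abs_sub_comm, show B ^ (-s) - B ^ (-s) * (B / A) ^ s = B ^ (-s) * (1 - (B / A) ^ s) by ring,
    abs_of_nonneg (mul_nonneg h7.le (by linarith))]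
  calc _ ≤ (1 / B + 1 / B ^ 2) * (4 / n) :=
        mul_le_mul h4 (by linarith) (by linarith) (by positivity)
    _ ≤ ((1 / (1 - x) + 1 / (1 - x) ^ 2) * (1 / n)) * (4 / n) :=
        mul_le_mul_of_nonneg_right h6 (by positivity)
    _ = _ := by field_simp

open Filter Topology Complex HurwitzZeta in
-- The terms `n` and `-n` of the series over the integers are paired. The pairing counts `n = 0`
-- twice, hence the extra `x ^ (-s) / 2` on the right.
theorem hasSum_hurwitzZetaOdd_add {x : ℝ} (hx0 : 0 < x) (hx1 : x < 1) {s : ℝ} (hs : 1 < s) :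
    HasSum (fun n : ℕ ↦ (if n = 0 then ((x ^ (-s) : ℝ) : ℂ) else
      (((n + x) ^ (-s) - (n - x) ^ (-s) : ℝ) : ℂ) / 2))
      (hurwitzZetaOdd (x : ℝ) s + ((x ^ (-s) : ℝ) : ℂ) / 2) := by
  have h := (hasSum_int_hurwitzZetaOdd x (s := s) (by simpa using hs)).nat_add_neg
  have e : ∀ y : ℝ, 0 < y → (SignType.sign y : ℂ) / ((|y| : ℝ) : ℂ) ^ (s : ℂ) / 2 =
      ((y ^ (-s) : ℝ) : ℂ) / 2 := fun y hy ↦ by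
    rw [sign_pos hy, abs_of_pos hy, Real.rpow_neg hy.le, ofReal_inv, ofReal_cpow hy.le]
    simp
  have e' : ∀ y : ℝ, 0 < y → (SignType.sign (-y) : ℂ) / ((|-y| : ℝ) : ℂ) ^ (s : ℂ) / 2 =
      -(((y ^ (-s) : ℝ) : ℂ) / 2) := fun y hy ↦ by
    rw [← e y hy, abs_neg, Left.sign_neg]
    simp [neg_div]
  convert h using 1
  · funext n
    rcases Nat.eq_zero_or_pos n with rfl | hn
    · simp only [if_true, Nat.cast_zero, Int.cast_zero, neg_zero, zero_add]
      rw [e x hx0]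
      ring
    · have hn1 : (1 : ℝ) ≤ n := by exact_mod_cast hn
      rw [if_neg hn.ne', Int.cast_neg, Int.cast_natCast, e _ (by linarith),
        show -(n : ℝ) + x = -(n - x) by ring, e' _ (by linarith)]
      push_cast
      ring
  · rw [Int.cast_zero, zero_add, e x hx0]

open Filter Topology Complex HurwitzZeta in
-- The paired series still converges at `s = 1`; continuity of the zeta function and dominated
-- convergence identify its sum there, which is the Mittag-Leffler expansion of the cotangent.
theorem hurwitzZetaOdd_one {x : ℝ} (hx0 : 0 < x) (hx1 : x < 1) :
    hurwitzZetaOdd (x : ℝ) 1 = Real.pi / 2 * cot (Real.pi * x) := by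
  set F : ℝ → ℕ → ℂ := fun s n ↦ if n = 0 then ((x ^ (-s) : ℝ) : ℂ) else
      (((n + x) ^ (-s) - (n - x) ^ (-s) : ℝ) : ℂ) / 2 with hF
  have hlim1 : Tendsto (fun s : ℝ ↦ hurwitzZetaOdd (x : ℝ) s + ((x ^ (-s) : ℝ) : ℂ) / 2) (𝓝[>] 1)
      (𝓝 (hurwitzZetaOdd (x : ℝ) 1 + ((x ^ (-1 : ℝ) : ℝ) : ℂ) / 2)) := by
    have hc : Continuous fun s : ℝ ↦ hurwitzZetaOdd (x : ℝ) s + ((x ^ (-s) : ℝ) : ℂ) / 2 := by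
      refine ((differentiable_hurwitzZetaOdd _).continuous.comp continuous_ofReal).add
        ((continuous_ofReal.comp ?_).div_const _)
      exact Continuous.rpow continuous_const continuous_neg fun _ ↦ Or.inl hx0.ne'
    simpa using (hc.tendsto 1).mono_left nhdsWithin_le_nhds
  have hlim2 : Tendsto (fun s : ℝ ↦ ∑' n, F s n) (𝓝[>] 1) (𝓝 (∑' n, F 1 n)) := by
    refine tendsto_tsum_of_dominated_convergence (bound := fun n : ℕ ↦ if n = 0 then x ^ (-2 : ℝ) else
      ((1 / (1 - x) + 1 / (1 - x) ^ 2) * 4 * (1 / (n : ℝ) ^ 2))) ?_ ?_ ?_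
    · have h1 := (Real.summable_one_div_nat_pow.mpr one_lt_two).mul_left
        ((1 / (1 - x) + 1 / (1 - x) ^ 2) * 4)
      refine (h1.congr_cofinite ?_)
      filter_upwards [(Set.finite_singleton 0).compl_mem_cofinite] with n hn
      rw [if_neg (by simpa using hn)]
    · intro n
      refine Tendsto.mono_left ?_ nhdsWithin_le_nhds
      refine Continuous.tendsto (f := fun s ↦ F s n) ?_ 1
      rcases Nat.eq_zero_or_pos n with rfl | hn
      · simp only [hF, if_true]
        exact continuous_ofReal.comp
          (Continuous.rpow continuous_const continuous_neg fun _ ↦ Or.inl hx0.ne')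
      · have hn1 : (1 : ℝ) ≤ n := by exact_mod_cast hn
        simp only [hF, if_neg hn.ne']
        refine (continuous_ofReal.comp (Continuous.sub ?_ ?_)).div_const _ <;>
        exact Continuous.rpow continuous_const continuous_neg fun _ ↦ Or.inl (by linarith)
    · have h2 : ∀ᶠ s : ℝ in 𝓝[>] 1, s < 2 :=
        (eventually_lt_nhds one_lt_two).filter_mono nhdsWithin_le_nhds
      filter_upwards [self_mem_nhdsWithin, h2] with s hs hs2 n
      have hs1 : (1 : ℝ) < s := hs
      rcases Nat.eq_zero_or_pos n with rfl | hn
      · simp only [hF, if_true]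
        rw [norm_real, Real.norm_eq_abs, abs_of_nonneg (Real.rpow_nonneg hx0.le _)]
        exact Real.rpow_le_rpow_of_exponent_ge hx0 hx1.le (by linarith)
      · simp only [hF, if_neg hn.ne']
        rw [norm_div, norm_real, Real.norm_eq_abs, Complex.norm_two]
        exact (div_le_self (abs_nonneg _) one_le_two).trans
          (abs_rpow_neg_sub_rpow_neg_le hx0 hx1 hn hs1.le hs2.le)
  have hsum1 : HasSum (F 1) (∑' n, F 1 n) := by
    refine Summable.hasSum (Summable.of_norm_bounded_eventually_nat (g := fun n : ℕ ↦
      ((1 / (1 - x) + 1 / (1 - x) ^ 2) * 4 * (1 / (n : ℝ) ^ 2)))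
      ((Real.summable_one_div_nat_pow.mpr one_lt_two).mul_left _) ?_)
    filter_upwards [eventually_ge_atTop 1] with n hn
    simp only [hF, if_neg (show n ≠ 0 by omega)]
    rw [norm_div, norm_real, Real.norm_eq_abs, Complex.norm_two]
    exact (div_le_self (abs_nonneg _) one_le_two).trans
      (abs_rpow_neg_sub_rpow_neg_le hx0 hx1 hn le_rfl one_le_two)
  have hval : ∑' n, F 1 n = hurwitzZetaOdd (x : ℝ) 1 + ((x ^ (-1 : ℝ) : ℝ) : ℂ) / 2 := by
    refine tendsto_nhds_unique hlim2 (hlim1.congr' ?_)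
    filter_upwards [self_mem_nhdsWithin] with s hs
    exact (hasSum_hurwitzZetaOdd_add hx0 hx1 hs).tsum_eq.symm
  have hmem : (x : ℂ) ∈ integerComplement := by
    rw [mem_integerComplement_iff]
    rintro ⟨m, hm⟩
    have hm' : (m : ℝ) = x := by exact_mod_cast hm
    have h1 : (0 : ℤ) < m := by exact_mod_cast hm' ▸ hx0
    have h2 : m < (1 : ℤ) := by exact_mod_cast hm' ▸ hx1
    omega
  have hcot := cot_series_rep hmem
  have hpn : ∑' n : ℕ+, (1 / ((x : ℂ) - n) + 1 / (x + n)) = 2 * ∑' n : ℕ, F 1 (n + 1) := by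
    rw [tsum_pnat_eq_tsum_succ (f := fun n : ℕ ↦ (1 / ((x : ℂ) - n) + 1 / (x + n))), ← tsum_mul_left]
    refine tsum_congr fun n ↦ ?_
    simp only [hF, if_neg (Nat.succ_ne_zero n)]
    rw [Real.rpow_neg_one, Real.rpow_neg_one]
    have h1 : (((n + 1 : ℕ) : ℝ) - x) ≠ 0 := by
      have : (0 : ℝ) ≤ n := Nat.cast_nonneg n
      push_cast
      linarith
    have h2 : (x : ℂ) - ((n + 1 : ℕ) : ℂ) = -(((((n + 1 : ℕ) : ℝ) - x) : ℝ) : ℂ) := by push_cast; ring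
    rw [h2, one_div, one_div, inv_neg]
    push_cast
    ring
  rw [hsum1.summable.tsum_eq_zero_add] at hval
  rw [hpn] at hcot
  have h0 : F 1 0 = ((x ^ (-1 : ℝ) : ℝ) : ℂ) := by simp [hF]
  rw [h0, Real.rpow_neg_one, ofReal_inv] at hval
  rw [one_div] at hcot
  linear_combination -hval - hcot / 2

/-! ### The Legendre character and its L-value at 1 as a finite sum. -/

theorem ZMod.sum_val_eq_sum_range {M : Type*} [AddCommMonoid M] (n : ℕ) [NeZero n] (f : ℕ → M) :
    ∑ x : ZMod n, f x.val = ∑ i ∈ Finset.range n, f i := by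
  obtain ⟨m, rfl⟩ := Nat.exists_eq_succ_of_ne_zero (NeZero.ne n)
  exact Fin.sum_univ_eq_sum_range f (m + 1)

/-- The Legendre symbol modulo `p` as a Dirichlet character. -/
noncomputable def legendreDirichletCharacter (p : ℕ) [Fact p.Prime] : DirichletCharacter ℂ p :=
  (quadraticChar (ZMod p)).ringHomComp (Int.castRingHom ℂ)

section LegendreCharacter

variable (p : ℕ) [Fact p.Prime]

theorem legendreDirichletCharacter_apply (a : ZMod p) :
    legendreDirichletCharacter p a = (quadraticChar (ZMod p) a : ℂ) := rfl

theorem ringChar_zmod_ne_two (hp2 : p ≠ 2) : ringChar (ZMod p) ≠ 2 := by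
  rwa [ZMod.ringChar_zmod_n]

theorem legendreDirichletCharacter_ne_one (hp2 : p ≠ 2) : legendreDirichletCharacter p ≠ 1 := by
  obtain ⟨a, ha⟩ := quadraticChar_exists_neg_one' (ringChar_zmod_ne_two p hp2)
  intro h
  have := legendreDirichletCharacter_apply p a
  rw [h, ha, MulChar.one_apply_coe] at this
  norm_num at this

theorem legendreDirichletCharacter_odd (hp4 : p % 4 = 3) : (legendreDirichletCharacter p).Odd := by
  have h : quadraticChar (ZMod p) (-1) = -1 := by
    rw [quadraticChar_neg_one_iff_not_isSquare, FiniteField.isSquare_neg_one_iff, ZMod.card]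
    simpa using hp4
  rw [DirichletCharacter.Odd, legendreDirichletCharacter_apply, h]
  norm_num

/-- An element `x` has `1 + χ(x)` square roots, so `∑ ψ(y²) = ∑ (1 + χ(x)) ψ(x)`, and the sum of `ψ`
alone vanishes. -/
theorem gaussSum_legendreDirichletCharacter (hp4 : p % 4 = 3) :
    gaussSum (legendreDirichletCharacter p) ZMod.stdAddChar = Complex.I * ((√p : ℝ) : ℂ) := by
  have hp2 : p ≠ 2 := by omega
  rw [← sum_exp_sq_div_eq p hp4]
  have h1 : ∑ x : ZMod p, ZMod.stdAddChar (N := p) x = 0 := by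
    have := AddChar.sum_eq_zero_of_ne_one (ψ := ZMod.stdAddChar (N := p))
      (by
        intro h
        exact one_ne_zero (α := ZMod p) (ZMod.injective_stdAddChar (by rw [h]; simp)))
    exact this
  have h2 : ∑ a : Fin p, Complex.exp (2 * Real.pi * Complex.I * ((a : ℕ) : ℂ) ^ 2 / p) =
      ∑ y : ZMod p, ZMod.stdAddChar (N := p) (y ^ 2) := by
    rw [Fin.sum_univ_eq_sum_range (fun a ↦ Complex.exp (2 * Real.pi * Complex.I * (a : ℂ) ^ 2 / p)) p,
      ← ZMod.sum_val_eq_sum_range]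
    refine Finset.sum_congr rfl fun y _ ↦ ?_
    have h := ZMod.stdAddChar_coe (N := p) ((y.val : ℤ) ^ 2)
    push_cast at h
    rw [ZMod.natCast_zmod_val] at h
    rw [h]
  rw [h2, ← Finset.sum_fiberwise Finset.univ (fun y : ZMod p ↦ y ^ 2)]
  rw [gaussSum, ← add_zero (∑ a, _), ← h1, ← Finset.sum_add_distrib]
  refine Finset.sum_congr rfl fun x _ ↦ ?_
  have h3 := quadraticChar_card_sqrts (ringChar_zmod_ne_two p hp2) x
  have h4 : ∑ y : ZMod p with y ^ 2 = x, ZMod.stdAddChar (N := p) (y ^ 2) =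
      ∑ y : ZMod p with y ^ 2 = x, ZMod.stdAddChar (N := p) x :=
    Finset.sum_congr rfl fun y hy ↦ by rw [(Finset.mem_filter.mp hy).2]
  rw [h4, Finset.sum_const, nsmul_eq_mul, legendreDirichletCharacter_apply]
  have h5 : (({y : ZMod p | y ^ 2 = x} : Finset (ZMod p)).card : ℤ) = quadraticChar (ZMod p) x + 1 := by
    rw [← h3]
    congr 2
    ext; simp
  have h6 : (({y : ZMod p | y ^ 2 = x} : Finset (ZMod p)).card : ℂ) =
      (quadraticChar (ZMod p) x : ℂ) + 1 := by exact_mod_cast h5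
  rw [h6]
  ring

theorem sum_legendreDirichletCharacter_mul_stdAddChar (hp4 : p % 4 = 3) (k : ZMod p) :
    ∑ a : ZMod p, legendreDirichletCharacter p a * ZMod.stdAddChar (N := p) (k * a) =
      legendreDirichletCharacter p k * (Complex.I * ((√p : ℝ) : ℂ)) := by
  have hp2 : p ≠ 2 := by omega
  by_cases hk : k = 0
  · subst hk
    have := MulChar.sum_eq_zero_of_ne_one (legendreDirichletCharacter_ne_one p hp2)
    simp [this, MulChar.map_zero (legendreDirichletCharacter p)]
  · have h := gaussSum_mulShift (legendreDirichletCharacter p) (ZMod.stdAddChar (N := p)) (Units.mk0 k hk)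
    rw [gaussSum_legendreDirichletCharacter p hp4, Units.val_mk0] at h
    have hsq : legendreDirichletCharacter p k * legendreDirichletCharacter p k = 1 := by
      rw [legendreDirichletCharacter_apply, ← Int.cast_mul, ← sq, quadraticChar_sq_one hk, Int.cast_one]
    rw [← h, ← mul_assoc, hsq, one_mul]
    rfl

end LegendreCharacter

theorem sub_one_mul_sum_mul_pow {R : Type*} [CommRing R] (z : R) (n : ℕ) :
    (z - 1) * ∑ k ∈ Finset.range n, (k : R) * z ^ k = n * z ^ n - ∑ k ∈ Finset.range n, z ^ (k + 1) := by
  induction n with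
  | zero => simp
  | succ n ih =>
    rw [Finset.sum_range_succ, Finset.sum_range_succ, mul_add, ih]
    push_cast
    ring

open Complex in
-- For a root of unity `z ≠ 1` of order dividing `p`, `∑ k z^k = p / (z - 1)`, and with `z = exp (2
-- I θ)` one has `1 / (z - 1) = -1/2 - (I / 2) cot θ`.
theorem sum_val_mul_stdAddChar (p : ℕ) [NeZero p] {a : ZMod p} (ha : a ≠ 0) :
    ∑ k : ZMod p, (k.val : ℂ) * ZMod.stdAddChar (N := p) (k * a) =
      p * (-1 / 2 - I / 2 * cot (Real.pi * ((a.val / p : ℝ) : ℂ))) := by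
  obtain ⟨n, rfl⟩ := Nat.exists_eq_succ_of_ne_zero (NeZero.ne p)
  set N := n + 1
  set z := ZMod.stdAddChar (N := N) a with hz
  have hz1 : z ≠ 1 := fun h ↦ ha (ZMod.injective_stdAddChar (by rw [← hz, h]; simp))
  have hzN : z ^ N = 1 := by rw [hz, ← AddChar.map_nsmul_eq_pow]; simp
  have h1 : ∑ k : ZMod N, (k.val : ℂ) * ZMod.stdAddChar (N := N) (k * a) =
      ∑ k ∈ Finset.range N, (k : ℂ) * z ^ k := by
    rw [← Fin.sum_univ_eq_sum_range (fun k ↦ (k : ℂ) * z ^ k) N]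
    refine Finset.sum_congr rfl fun k _ ↦ ?_
    have : (k : ZMod N) * a = (ZMod.val k) • a := by simp
    rw [this, AddChar.map_nsmul_eq_pow]
    rfl
  have h2 : ∑ k ∈ Finset.range N, z ^ (k + 1) = 0 := by
    simp only [pow_succ, ← Finset.sum_mul]
    have := geom_sum_mul z N
    rw [hzN, sub_self] at this
    rw [(mul_eq_zero.mp this).resolve_right (sub_ne_zero.mpr hz1), zero_mul]
  have h3 := sub_one_mul_sum_mul_pow z N
  rw [h2, hzN, mul_one, sub_zero] at h3
  have h4 : cexp (2 * I * (Real.pi * ((a.val / N : ℝ) : ℂ))) = z := by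
    have := ZMod.stdAddChar_coe (N := N) (a.val : ℤ)
    rw [Int.cast_natCast, ZMod.natCast_zmod_val] at this
    rw [hz, this]
    congr 1
    push_cast
    ring
  have hz1' : 1 - z ≠ 0 := sub_ne_zero.mpr hz1.symm
  have hz1'' : z - 1 ≠ 0 := sub_ne_zero.mpr hz1
  rw [h1, cot_eq_exp_ratio, h4]
  apply mul_left_cancel₀ hz1''
  rw [h3]
  have := I_ne_zero
  field_simp
  ring

open Complex in
-- By oddness `L(1, χ)` is a sum of values of `hurwitzZetaOdd`, that is, of cotangents. The same
-- cotangent sum appears when `χ(k)` times the Gauss sum is written as `∑ χ(a) ψ(k a)` and the sum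
-- over `k` is carried out first.
theorem LFunction_legendreDirichletCharacter_one (p : ℕ) [Fact p.Prime] (hp4 : p % 4 = 3) :
    (legendreDirichletCharacter p).LFunction 1 =
      -(Real.pi / (p * ((√p : ℝ) : ℂ))) * ∑ k : ZMod p, legendreDirichletCharacter p k * k.val := by
  have hp : (0 : ℝ) < p := by exact_mod_cast (Fact.out : p.Prime).pos
  have hpc : (p : ℂ) ≠ 0 := by exact_mod_cast hp.ne'
  have hp2 : p ≠ 2 := by omega
  have hodd := (legendreDirichletCharacter_odd p hp4).to_fun
  have htwist := sum_legendreDirichletCharacter_mul_stdAddChar p hp4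
  have hsum := MulChar.sum_eq_zero_of_ne_one (legendreDirichletCharacter_ne_one p hp2)
  generalize legendreDirichletCharacter p = χ at hodd htwist hsum ⊢
  set C : ℂ := ∑ a : ZMod p, χ a * cot (Real.pi * ((a.val / p : ℝ) : ℂ)) with hC
  have hχ0 : χ 0 = 0 := MulChar.map_zero χ
  have h1 : χ.LFunction 1 = Real.pi / (2 * p) * C := by
    rw [DirichletCharacter.LFunction,
ZMod.LFunction_def_odd hodd, cpow_neg_one, hC,
      Finset.mul_sum, Finset.mul_sum]
    refine Finset.sum_congr rfl fun a _ ↦ ?_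
    by_cases ha : a = 0
    · simp [ha, hχ0]
    · have hv : 0 < a.val := Nat.pos_of_ne_zero ((ZMod.val_ne_zero a).mpr ha)
      rw [ZMod.toAddCircle_apply, hurwitzZetaOdd_one (by positivity)
        ((div_lt_one hp).mpr (by exact_mod_cast ZMod.val_lt a))]
      field_simp
  have h2 : (∑ k : ZMod p, χ k * k.val) * (I * ((√p : ℝ) : ℂ)) = -(I * p / 2) * C := by
    calc _ = ∑ k : ZMod p, ∑ a : ZMod p, (k.val : ℂ) * (χ a * ZMod.stdAddChar (N := p) (k * a)) := by
          rw [Finset.sum_mul]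
          refine Finset.sum_congr rfl fun k _ ↦ ?_
          rw [← Finset.mul_sum, htwist]
          ring
      _ = ∑ a : ZMod p, χ a * ∑ k : ZMod p, (k.val : ℂ) * ZMod.stdAddChar (N := p) (k * a) := by
          rw [Finset.sum_comm]
          refine Finset.sum_congr rfl fun a _ ↦ ?_
          rw [Finset.mul_sum]
          exact Finset.sum_congr rfl fun k _ ↦ by ring
      _ = ∑ a : ZMod p, (-(p / 2) * χ a + -(I * p / 2) * (χ a * cot (Real.pi * ((a.val / p : ℝ) : ℂ)))) := by
          refine Finset.sum_congr rfl fun a _ ↦ ?_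
          by_cases ha : a = 0
          · simp [ha, hχ0]
          · rw [sum_val_mul_stdAddChar p ha]
            ring
      _ = _ := by
          rw [Finset.sum_add_distrib, ← Finset.mul_sum, ← Finset.mul_sum,
            hsum, mul_zero, zero_add]
  have hsp : (((√p : ℝ) : ℂ)) ^ 2 = p := by
    rw [← ofReal_pow, Real.sq_sqrt hp.le, ofReal_natCast]
  have hsp0 : ((√p : ℝ) : ℂ) ≠ 0 := by
    rw [ofReal_ne_zero]; exact (Real.sqrt_pos.mpr hp).ne'
  have h3 : (∑ k : ZMod p, χ k * k.val) * ((√p : ℝ) : ℂ) = -(p / 2) * C := by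
    apply mul_left_cancel₀ I_ne_zero
    linear_combination h2
  rw [h1]
  apply mul_right_cancel₀ hsp0
  rw [mul_assoc (-_), h3]
  field_simp
  rw [hsp]
  ring

/-! ### The field generated by a square root of `-p`: integers, units, discriminant, residue. -/

theorem Rat.exists_intCast_of_isIntegral {A : Type*} [Field A] [CharZero A] {q : ℚ}
    (h : IsIntegral ℤ (q : A)) : ∃ n : ℤ, q = n := by
  have h1 : IsIntegral ℤ (algebraMap ℚ A q) := by simpa using h
  rw [isIntegral_algebraMap_iff (algebraMap ℚ A).injective] at h1
  obtain ⟨n, hn⟩ := IsIntegrallyClosed.isIntegral_iff.mp h1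
  exact ⟨n, by simpa using hn.symm⟩

/-- `p * w` is an integer because its square is `p * c`; then `p` divides that square, hence `p * w`
itself. -/
theorem Rat.exists_intCast_of_prime_mul_sq {p : ℕ} (hp : p.Prime) {w : ℚ} {c : ℤ}
    (h : p * w ^ 2 = c) : ∃ n : ℤ, w = n := by
  obtain ⟨k, hk⟩ : ∃ k : ℤ, p * w = k := by
    apply Rat.exists_intCast_of_isIntegral (A := ℚ)
    refine IsIntegral.of_pow two_pos ?_
    have : ((p * w : ℚ) : ℚ) ^ 2 = ((p * c : ℤ) : ℚ) := by
      push_cast; rw [← h]; ring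
    rw [Rat.cast_id, this]
    exact isIntegral_algebraMap (R := ℤ) (A := ℚ) (x := (p * c : ℤ))
  have hp0 : (p : ℚ) ≠ 0 := by exact_mod_cast hp.ne_zero
  have h1 : k ^ 2 = p * c := by
    have : (k : ℚ) ^ 2 = p * c := by rw [← hk, ← h]; ring
    exact_mod_cast this
  have h2 : (p : ℤ) ∣ k := (Nat.prime_iff_prime_int.mp hp).dvd_of_dvd_pow ⟨c, h1⟩
  obtain ⟨n, rfl⟩ := h2
  refine ⟨n, mul_left_cancel₀ hp0 ?_⟩
  rw [hk]; push_cast; ring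

section Coordinates

variable {K : Type*} [Field K] {p : ℕ} {α : K}

theorem exists_rat_add_mul_of_adjoin_eq_top [CharZero K] [Algebra.IsAlgebraic ℚ K] (hα : α ^ 2 = -(p : K))
    (htop : IntermediateField.adjoin ℚ {α} = ⊤) (x : K) : ∃ u v : ℚ, x = u + v * α := by
  have h1 : x ∈ Algebra.adjoin ℚ {α} := by
    rw [← IntermediateField.adjoin_simple_toSubalgebra_of_isAlgebraic
      (Algebra.IsAlgebraic.isAlgebraic (R := ℚ) α), htop]
    exact Algebra.mem_top
  induction h1 using Algebra.adjoin_induction with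
  | mem x hx => rw [Set.mem_singleton_iff] at hx; exact ⟨0, 1, by simp [hx]⟩
  | algebraMap r => exact ⟨r, 0, by simp⟩
  | add x y _ _ hx hy =>
    obtain ⟨u, v, rfl⟩ := hx
    obtain ⟨u', v', rfl⟩ := hy
    exact ⟨u + u', v + v', by push_cast; ring⟩
  | mul x y _ _ hx hy =>
    obtain ⟨u, v, rfl⟩ := hx
    obtain ⟨u', v', rfl⟩ := hy
    exact ⟨u * u' - p * v * v', u * v' + v * u', by push_cast; linear_combination (v * v' : K) * hα⟩

theorem rat_add_mul_eq_zero [CharZero K] (hp : 0 < p) (hα : α ^ 2 = -(p : K)) {u v : ℚ}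
    (h : (u : K) + v * α = 0) : u = 0 ∧ v = 0 := by
  have h1 : (u : K) ^ 2 = -(p * v ^ 2 : K) := by
    linear_combination (u - v * α : K) * h + (v : K) ^ 2 * hα
  have h2 : u ^ 2 = -(p * v ^ 2) := by exact_mod_cast h1
  have hp' : (0 : ℚ) < p := by exact_mod_cast hp
  have hv : v = 0 := by
    by_contra hv
    have : 0 < v ^ 2 := by positivity
    nlinarith [sq_nonneg u]
  subst hv
  simpa using h2

theorem conj_embedding_eq_neg (hp : 0 < p) (hα : α ^ 2 = -(p : K)) (φ : K →+* ℂ) :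
    starRingEnd ℂ (φ α) = -φ α := by
  have h1 : (φ α) ^ 2 = -(p : ℂ) := by rw [← map_pow, hα]; simp
  have h2 : (starRingEnd ℂ (φ α)) ^ 2 = (φ α) ^ 2 := by rw [← map_pow, h1]; simp
  rcases sq_eq_sq_iff_eq_or_eq_neg.mp h2 with h | h
  · obtain ⟨r, hr⟩ := Complex.conj_eq_iff_real.mp h
    rw [hr] at h1
    have h3 : r ^ 2 = -(p : ℝ) := by exact_mod_cast h1
    have hp' : (0 : ℝ) < p := by exact_mod_cast hp
    nlinarith [sq_nonneg r]
  · exact h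

/-- Trace `2u` and norm `u² + p v²` are integers, read off in `ℂ`, where conjugation negates `α`.
Then `2v` is an integer too, and it has the parity of `2u` by reduction of `T² + p w² = 4N` modulo
2. -/
theorem exists_int_add_mul_of_isIntegral [NumberField K] (hp : p.Prime) (hp4 : p % 4 = 3)
    (hα : α ^ 2 = -(p : K)) (htop : IntermediateField.adjoin ℚ {α} = ⊤) {x : K}
    (hx : IsIntegral ℤ x) : ∃ a b : ℤ, x = a + b * ((1 + α) / 2) := by
  obtain ⟨u, v, rfl⟩ := exists_rat_add_mul_of_adjoin_eq_top hα htop x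
  obtain ⟨φ⟩ : Nonempty (K →+* ℂ) := inferInstance
  have h1 : IsIntegral ℤ ((u : ℂ) + v * φ α) := by
    simpa using hx.map φ.toIntAlgHom
  have h2 : IsIntegral ℤ ((u : ℂ) - v * φ α) := by
    have := h1.map (starRingEnd ℂ).toIntAlgHom
    simpa [conj_embedding_eq_neg hp.pos hα φ, sub_eq_add_neg] using this
  obtain ⟨T, hT⟩ : ∃ T : ℤ, 2 * u = T := by
    refine Rat.exists_intCast_of_isIntegral (A := ℂ) ?_
    have : ((2 * u : ℚ) : ℂ) = (u + v * φ α) + (u - v * φ α) := by push_cast; ring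
    exact this ▸ h1.add h2
  have h3 : (φ α) ^ 2 = -(p : ℂ) := by rw [← map_pow, hα]; simp
  obtain ⟨N, hN⟩ : ∃ N : ℤ, u ^ 2 + p * v ^ 2 = N := by
    refine Rat.exists_intCast_of_isIntegral (A := ℂ) ?_
    have : ((u ^ 2 + p * v ^ 2 : ℚ) : ℂ) = (u + v * φ α) * (u - v * φ α) := by
      push_cast
      linear_combination (v : ℂ) ^ 2 * h3
    exact this ▸ h1.mul h2
  obtain ⟨w, hw⟩ : ∃ w : ℤ, 2 * v = w := by
    refine Rat.exists_intCast_of_prime_mul_sq hp (c := 4 * N - T ^ 2) ?_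
    push_cast
    rw [← hT, ← hN]; ring
  have h4 : T ^ 2 + p * w ^ 2 = 4 * N := by
    have : (T : ℚ) ^ 2 + p * w ^ 2 = 4 * N := by rw [← hT, ← hN, ← hw]; ring
    exact_mod_cast this
  obtain ⟨k, hk⟩ : ∃ k, T - w = 2 * k := by
    obtain ⟨m, hm⟩ : ∃ m, p = 4 * m + 3 := ⟨p / 4, by omega⟩
    have h5 : Even ((T - w) ^ 2) := by
      refine ⟨2 * N - 2 * m * w ^ 2 - w ^ 2 - T * w, ?_⟩
      rw [hm] at h4
      push_cast at h4
      linear_combination h4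
    rw [Int.even_pow] at h5
    exact h5.1.two_dvd
  refine ⟨k, w, ?_⟩
  have hu : u = k + w / 2 := by
    have : (T : ℚ) - w = 2 * k := by exact_mod_cast hk
    linarith
  have hv : v = w / 2 := by linarith
  rw [hu, hv]
  push_cast
  ring

end Coordinates

open NumberField in
theorem exists_basis_ringOfIntegers {K : Type*} [Field K] [NumberField K] {p m : ℕ} {α : K}
    (hp : p.Prime) (hm : p + 1 = 4 * m) (hα : α ^ 2 = -(p : K))
    (htop : IntermediateField.adjoin ℚ {α} = ⊤) :
    ∃ b : Module.Basis (Fin 2) ℤ (𝓞 K), b 0 = 1 ∧ b 1 ^ 2 = b 1 - m := by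
  have hm' : (p : K) = 4 * m - 1 := by
    have : ((p + 1 : ℕ) : K) = ((4 * m : ℕ) : K) := by rw [hm]
    push_cast at this
    linear_combination this
  set w : K := (1 + α) / 2 with hw
  have hw2 : w ^ 2 = w - m := by
    rw [hw]
    linear_combination hα / 4 - hm' / 4
  have hwint : IsIntegral ℤ w := by
    refine ⟨Polynomial.X ^ 2 - Polynomial.X + Polynomial.C (m : ℤ), by monicity!, ?_⟩
    simp [hw2]
  obtain ⟨ω, hω⟩ : ∃ ω : 𝓞 K, (ω : K) = w := ⟨⟨w, hwint⟩, rfl⟩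
  have hli : LinearIndependent ℤ ![(1 : 𝓞 K), ω] := by
    rw [LinearIndependent.pair_iff]
    intro s t h
    have h1 : (s : K) + t * w = 0 := by
      have := congrArg (algebraMap (𝓞 K) K) h
      simpa [zsmul_eq_mul, hω] using this
    have h2 : (((s : ℚ) + t / 2 : ℚ) : K) + ((t / 2 : ℚ) : K) * α = 0 := by
      push_cast
      rw [hw] at h1
      linear_combination h1
    obtain ⟨h3, h4⟩ := rat_add_mul_eq_zero hp.pos hα h2
    have h5 : (t : ℚ) = 0 := by linarith
    have h6 : (s : ℚ) = 0 := by linarith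
    exact ⟨by exact_mod_cast h6, by exact_mod_cast h5⟩
  have hsp : ⊤ ≤ Submodule.span ℤ (Set.range ![(1 : 𝓞 K), ω]) := by
    rintro x -
    obtain ⟨a, c, h⟩ := exists_int_add_mul_of_isIntegral hp (by omega) hα htop x.isIntegral_coe
    have hx : x = a • (1 : 𝓞 K) + c • ω := by
      apply RingOfIntegers.ext
      refine h.trans ?_
      simp [zsmul_eq_mul, hω, hw]
    rw [hx]
    refine Submodule.add_mem _ (Submodule.smul_mem _ _ (Submodule.subset_span ⟨0, rfl⟩))
      (Submodule.smul_mem _ _ (Submodule.subset_span ⟨1, rfl⟩))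
  refine ⟨Module.Basis.mk hli hsp, by simp, ?_⟩
  simp only [Module.Basis.mk_apply, Matrix.cons_val_one]
  apply RingOfIntegers.ext
  simpa [hω] using hw2

section QuadraticBasis

open NumberField

variable {K : Type*} [Field K] {m p : ℕ} {b : Module.Basis (Fin 2) ℤ (𝓞 K)}

theorem eq_repr_add_repr_mul (hb0 : b 0 = 1) (x : 𝓞 K) :
    x = (b.repr x 0 : 𝓞 K) + b.repr x 1 * b 1 := by
  conv_lhs => rw [← b.sum_repr x]
  rw [Fin.sum_univ_two, hb0]
  simp [zsmul_eq_mul]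

theorem repr_int_add_int_mul (hb0 : b 0 = 1) (a c : ℤ) :
    b.repr ((a : 𝓞 K) + c * b 1) 0 = a ∧ b.repr ((a : 𝓞 K) + c * b 1) 1 = c := by
  have : (a : 𝓞 K) + c * b 1 = a • b 0 + c • b 1 := by simp [hb0, zsmul_eq_mul]
  rw [this, map_add, map_zsmul, map_zsmul]
  simp

theorem repr_mul (hb0 : b 0 = 1) (hb1 : b 1 ^ 2 = b 1 - m) (x y : 𝓞 K) :
    b.repr (x * y) 0 = b.repr x 0 * b.repr y 0 - m * (b.repr x 1 * b.repr y 1) ∧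
    b.repr (x * y) 1 = b.repr x 0 * b.repr y 1 + b.repr x 1 * b.repr y 0 + b.repr x 1 * b.repr y 1 := by
  have h : x * y = ((b.repr x 0 * b.repr y 0 - m * (b.repr x 1 * b.repr y 1) : ℤ) : 𝓞 K) +
      ((b.repr x 0 * b.repr y 1 + b.repr x 1 * b.repr y 0 + b.repr x 1 * b.repr y 1 : ℤ) : 𝓞 K) * b 1 := by
    conv_lhs => rw [eq_repr_add_repr_mul hb0 x, eq_repr_add_repr_mul hb0 y]
    push_cast
    linear_combination (b.repr x 1 * b.repr y 1 : 𝓞 K) * hb1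
  rw [h]
  exact repr_int_add_int_mul hb0 _ _

/-- The norm form satisfies `4 (a² + a c + m c²) = (2a + c)² + (4m - 1) c²`. For `m ≥ 2` the value 1
forces `c = 0`; `m = 1` would be the Eisenstein integers, with six units. -/
theorem unit_eq_one_or_eq_neg_one (hb0 : b 0 = 1) (hb1 : b 1 ^ 2 = b 1 - m) (hm : 2 ≤ m) (u : (𝓞 K)ˣ) :
    u = 1 ∨ u = -1 := by
  set N : 𝓞 K → ℤ := fun x ↦ b.repr x 0 ^ 2 + b.repr x 0 * b.repr x 1 + m * b.repr x 1 ^ 2 with hN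
  have hmul : ∀ x y, N (x * y) = N x * N y := fun x y ↦ by
    simp only [hN, (repr_mul hb0 hb1 x y).1, (repr_mul hb0 hb1 x y).2]
    ring
  have hm' : (2 : ℤ) ≤ m := by exact_mod_cast hm
  have hnn : ∀ x, 0 ≤ N x := fun x ↦ by
    simp only [hN]
    nlinarith [sq_nonneg (2 * b.repr x 0 + b.repr x 1), sq_nonneg (b.repr x 1)]
  have h1 : N 1 = 1 := by
    have := repr_int_add_int_mul hb0 1 0
    simp only [Int.cast_one, Int.cast_zero, zero_mul, add_zero] at this
    simp [hN, this]
  have h2 : N (u : 𝓞 K) = 1 := by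
    have h3 : N (u : 𝓞 K) * N (u⁻¹ : (𝓞 K)ˣ) = 1 := by rw [← hmul, Units.mul_inv, h1]
    exact Int.eq_one_of_mul_eq_one_right (hnn _) h3
  simp only [hN] at h2
  have hx := eq_repr_add_repr_mul hb0 (u : 𝓞 K)
  generalize b.repr (u : 𝓞 K) 0 = a at h2 hx
  generalize b.repr (u : 𝓞 K) 1 = c at h2 hx
  have hc : c = 0 := by
    by_contra hc
    have : 1 ≤ c ^ 2 := by
      have := Int.one_le_abs hc
      nlinarith [sq_abs c]
    nlinarith [sq_nonneg (2 * a + c)]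
  subst hc
  have ha : a ^ 2 = 1 := by linarith
  rcases (Commute.all a 1).sq_eq_sq_iff_eq_or_eq_neg.mp (by rw [ha, one_pow]) with rfl | rfl
  · left; ext; simp [hx]
  · right; ext; simp [hx]

variable [NumberField K]

theorem finrank_of_basis_fin_two (b : Module.Basis (Fin 2) ℤ (𝓞 K)) : Module.finrank ℚ K = 2 := by
  rw [← RingOfIntegers.rank, Module.finrank_eq_card_basis b, Fintype.card_fin]

theorem torsionOrder_eq_two (hb0 : b 0 = 1) (hb1 : b 1 ^ 2 = b 1 - m) (hm : 2 ≤ m) :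
    Units.torsionOrder K = 2 := by
  rw [Units.torsionOrder, Nat.card_eq_two_iff]
  refine ⟨1, ⟨-1, ?_⟩, ?_, ?_⟩
  · exact (CommGroup.mem_torsion _).mpr (isOfFinOrder_iff_pow_eq_one.mpr ⟨2, two_pos, by simp⟩)
  · intro h
    have h1 := congrArg (fun x : Units.torsion K ↦ ((x : (𝓞 K)ˣ) : 𝓞 K)) h
    exact one_ne_zero (self_eq_neg.mp (by simpa using h1))
  · ext ⟨u, hu⟩
    have := unit_eq_one_or_eq_neg_one hb0 hb1 hm u
    simpa [Subtype.ext_iff] using this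

theorem discr_eq_of_basis (hb0 : b 0 = 1) (hb1 : b 1 ^ 2 = b 1 - m) : discr K = 1 - 4 * m := by
  have htr : ∀ x : 𝓞 K, Algebra.trace ℤ (𝓞 K) x = 2 * b.repr x 0 + b.repr x 1 := fun x ↦ by
    have h1 : b.repr (b 1) 0 = 0 ∧ b.repr (b 1) 1 = 1 := by simp
    rw [Algebra.trace_eq_matrix_trace b, Matrix.trace, Fin.sum_univ_two]
    simp only [Matrix.diag, Algebra.leftMulMatrix_eq_repr_mul]
    rw [hb0, mul_one, (repr_mul hb0 hb1 x (b 1)).2, h1.1, h1.2]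
    ring
  have h1 := repr_int_add_int_mul hb0 1 0
  have h2 := repr_int_add_int_mul hb0 0 1
  simp only [Int.cast_one, Int.cast_zero, zero_mul, add_zero, one_mul, zero_add] at h1 h2
  rw [← NumberField.discr_eq_discr K b, Algebra.discr_def, Matrix.det_fin_two]
  simp only [Algebra.traceMatrix_apply, Algebra.traceForm_apply, htr, (repr_mul hb0 hb1 _ _).1,
    (repr_mul hb0 hb1 _ _).2, hb0, h1, h2]
  ring

end QuadraticBasis

theorem Matrix.det_eq_one_of_isEmpty {n R : Type*} {_ : DecidableEq n} {_ : Fintype n} [CommRing R]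
    (h : IsEmpty n) (A : Matrix n n R) : A.det = 1 :=
  Matrix.det_isEmpty

section Imaginary

open NumberField

variable {K : Type*} [Field K] [NumberField K] {p : ℕ} {α : K}

theorem isTotallyComplex_of_sq_eq_neg (hp : 0 < p) (hα : α ^ 2 = -(p : K)) : IsTotallyComplex K := by
  refine ⟨fun w ↦ ?_⟩
  rw [← InfinitePlace.not_isReal_iff_isComplex]
  intro hw
  have h := hw
  rw [InfinitePlace.isReal_iff, ComplexEmbedding.isReal_iff] at h
  have h1 := conj_embedding_eq_neg hp hα w.embedding
  have h2 := RingHom.congr_fun h α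
  rw [ComplexEmbedding.conjugate_coe_eq] at h2
  rw [h2, self_eq_neg] at h1
  have h3 : α = 0 := by simpa using h1
  rw [h3] at hα
  have : (p : K) ≠ 0 := by exact_mod_cast hp.ne'
  simp at hα
  omega

/-- One complex place, no real place, unit rank 0 (so the regulator is an empty determinant), two
roots of unity, and `|discr| = p`. -/
theorem dedekindZeta_residue_eq (hα : α ^ 2 = -(p : K)) {m : ℕ} {b : Module.Basis (Fin 2) ℤ (𝓞 K)} (hb0 : b 0 = 1)
    (hb1 : b 1 ^ 2 = b 1 - m) (hm : 2 ≤ m) (hpm : p + 1 = 4 * m) :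
    dedekindZeta_residue K = Real.pi * classNumber K / √p := by
  have := isTotallyComplex_of_sq_eq_neg (by omega) hα
  have hr : InfinitePlace.nrRealPlaces K = 0 := IsTotallyComplex.nrRealPlaces_eq_zero K
  have hc : InfinitePlace.nrComplexPlaces K = 1 := by
    have := InfinitePlace.card_add_two_mul_card_eq_rank K
    rw [hr, finrank_of_basis_fin_two b] at this
    omega
  have hrank : Units.rank K = 0 := by
    rw [Units.rank, InfinitePlace.card_eq_nrRealPlaces_add_nrComplexPlaces, hr, hc]
  have hreg : Units.regulator K = 1 := by
    obtain ⟨w⟩ : Nonempty (InfinitePlace K) := inferInstance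
    have he : IsEmpty {w' // w' ≠ w} := by
      have : Subsingleton (InfinitePlace K) := by
        rw [← Fintype.card_le_one_iff_subsingleton,
          InfinitePlace.card_eq_nrRealPlaces_add_nrComplexPlaces, hr, hc]
      exact ⟨fun x ↦ x.2 (Subsingleton.elim _ _)⟩
    have hf : IsEmpty (Fin (Units.rank K)) := by rw [hrank]; infer_instance
    rw [Units.regulator_eq_det K w (Equiv.equivOfIsEmpty _ _), Matrix.det_eq_one_of_isEmpty he, abs_one]
  have hd : |(discr K : ℝ)| = p := by
    rw [discr_eq_of_basis hb0 hb1]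
    have : (p : ℝ) + 1 = 4 * m := by exact_mod_cast hpm
    push_cast
    rw [show (1 : ℝ) - 4 * m = -p by linarith, abs_neg, Nat.abs_cast]
  rw [dedekindZeta_residue_def, hr, hc, hreg, torsionOrder_eq_two hb0 hb1 hm, hd]
  push_cast
  ring

end Imaginary

/-! ### Counting ideals of given norm. -/

section IdealCount

open NumberField Ideal

variable {R : Type*} [CommRing R] [IsDedekindDomain R] [Module.Free ℤ R]

theorem Ideal.dvd_span_natCast_pow {I : Ideal R} {q k : ℕ} (hI : absNorm I = q ^ k) :
    I ∣ span {(q : R)} ^ k := by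
  rw [span_singleton_pow, dvd_iff_le, span_singleton_le_iff_mem]
  have := absNorm_mem I
  rwa [hI, Nat.cast_pow] at this

theorem Ideal.prime_of_absNorm_prime {P : Ideal R} {q : ℕ} (hq : q.Prime) (hP : absNorm P = q) :
    Prime P :=
  UniqueFactorizationMonoid.irreducible_iff_prime.mp
    (irreducible_of_irreducible_absNorm (hP ▸ hq))

/-- An ideal of norm `q ^ k` divides `(q) ^ k`, so only primes above `q` occur in it; here that
leaves the powers of `(q)`, whose norms are even powers of `q`. The other two splitting types are
treated in the same way. -/
theorem Ideal.card_absNorm_eq_pow_of_inert {q : ℕ} (hq : q.Prime) (hP : Prime (span {(q : R)}))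
    (hN : absNorm (span {(q : R)}) = q ^ 2) (k : ℕ) :
    Nat.card {I : Ideal R // absNorm I = q ^ k} = if Even k then 1 else 0 := by
  have key : ∀ I : Ideal R, absNorm I = q ^ k → ∃ i, I = span {(q : R)} ^ i ∧ k = 2 * i := fun I hI ↦ by
    obtain ⟨i, -, hi⟩ := (dvd_prime_pow hP k).mp (dvd_span_natCast_pow hI)
    rw [associated_iff_eq] at hi
    refine ⟨i, hi, ?_⟩
    rw [hi, map_pow, hN, ← pow_mul] at hI
    exact (Nat.pow_right_injective hq.two_le hI).symm
  split_ifs with hk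
  · obtain ⟨i, hi⟩ := hk
    rw [Nat.card_eq_one_iff_unique]
    refine ⟨⟨fun I J ↦ ?_⟩, ⟨⟨span {(q : R)} ^ i, by rw [map_pow, hN, ← pow_mul, hi, two_mul]⟩⟩⟩
    obtain ⟨a, ha, ha'⟩ := key I I.2
    obtain ⟨c, hc, hc'⟩ := key J J.2
    apply Subtype.ext
    rw [ha, hc, show a = c by omega]
  · rw [Nat.card_eq_zero]
    left
    refine ⟨fun I ↦ hk ?_⟩
    obtain ⟨a, -, ha'⟩ := key I I.2
    exact ⟨a, by omega⟩

theorem Ideal.card_absNorm_eq_pow_of_ramified {q : ℕ} (hq : q.Prime) {P : Ideal R}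
    (hP : absNorm P = q) (hP2 : P ^ 2 = span {(q : R)}) (k : ℕ) :
    Nat.card {I : Ideal R // absNorm I = q ^ k} = 1 := by
  have hprime := prime_of_absNorm_prime hq hP
  rw [Nat.card_eq_one_iff_unique]
  have key : ∀ I : Ideal R, absNorm I = q ^ k → I = P ^ k := fun I hI ↦ by
    have h := dvd_span_natCast_pow hI
    rw [← hP2, ← pow_mul] at h
    obtain ⟨i, -, hi⟩ := (dvd_prime_pow hprime _).mp h
    rw [associated_iff_eq] at hi
    rw [hi, map_pow, hP] at hI
    rw [hi, Nat.pow_right_injective hq.two_le hI]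
  exact ⟨⟨fun I J ↦ Subtype.ext ((key I I.2).trans (key J J.2).symm)⟩, ⟨⟨P ^ k, by rw [map_pow, hP]⟩⟩⟩

theorem Ideal.card_absNorm_eq_pow_of_split {q : ℕ} (hq : q.Prime) {P P' : Ideal R}
    (hP : absNorm P = q) (hP' : absNorm P' = q) (hne : P ≠ P') (hPP' : P * P' = span {(q : R)}) (k : ℕ) :
    Nat.card {I : Ideal R // absNorm I = q ^ k} = k + 1 := by
  have hprime := prime_of_absNorm_prime hq hP
  have hprime' := prime_of_absNorm_prime hq hP'
  have hnd : ¬ P ∣ P' := fun h ↦ hne (associated_iff_eq.mp (hprime.associated_of_dvd hprime' h))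
  have hinj : ∀ i j k, i < j → j ≤ k → P ^ i * P' ^ (k - i) ≠ P ^ j * P' ^ (k - j) :=
    fun i j k hij hjk h ↦ by
      rw [show k - i = (j - i) + (k - j) by omega, pow_add, ← mul_assoc] at h
      have h1 := mul_right_cancel₀ (pow_ne_zero _ hprime'.ne_zero) h
      rw [show P ^ j = P ^ i * P ^ (j - i) by rw [← pow_add]; congr 1; omega] at h1
      have h2 := mul_left_cancel₀ (pow_ne_zero _ hprime.ne_zero) h1
      exact hnd (hprime.dvd_of_dvd_pow (h2 ▸ dvd_pow_self P (by omega)))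
  rw [← Nat.card_fin (k + 1)]
  symm
  refine Nat.card_congr (Equiv.ofBijective (fun i : Fin (k + 1) ↦
    (⟨P ^ (i : ℕ) * P' ^ (k - i), by
      rw [map_mul, map_pow, map_pow, hP, hP', ← pow_add]; congr 1; omega⟩ :
      {I : Ideal R // absNorm I = q ^ k})) ⟨?_, ?_⟩)
  · intro i j hij
    simp only [Subtype.mk.injEq] at hij
    rcases lt_trichotomy i j with h | h | h
    · exact absurd hij (hinj _ _ k h (by omega))
    · exact h
    · exact absurd hij.symm (hinj _ _ k h (by omega))
  · rintro ⟨I, hI⟩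
    have h := dvd_span_natCast_pow hI
    rw [← hPP', mul_pow] at h
    obtain ⟨A, B, hA, hB, rfl⟩ := exists_dvd_and_dvd_of_dvd_mul h
    obtain ⟨i, -, hi⟩ := (dvd_prime_pow hprime _).mp hA
    obtain ⟨j, -, hj⟩ := (dvd_prime_pow hprime' _).mp hB
    rw [associated_iff_eq] at hi hj
    subst hi hj
    rw [map_mul, map_pow, map_pow, hP, hP', ← pow_add] at hI
    have hij := Nat.pow_right_injective hq.two_le hI
    refine ⟨⟨i, by omega⟩, Subtype.ext ?_⟩
    simp only
    rw [show k - i = j by omega]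

variable [CharZero R]

theorem Ideal.isCoprime_of_coprime_absNorm {I J : Ideal R} (h : (absNorm I).Coprime (absNorm J)) :
    IsCoprime I J := by
  rw [Ideal.isCoprime_iff_exists]
  obtain ⟨u, v, huv⟩ := Nat.isCoprime_iff_coprime.mpr h
  refine ⟨u * absNorm I, I.mul_mem_left _ (absNorm_mem I), v * absNorm J,
    J.mul_mem_left _ (absNorm_mem J), ?_⟩
  exact_mod_cast congrArg (Int.cast (R := R)) huv

variable [Module.Finite ℤ R]

/-- An ideal of norm `m * n` divides `(m) * (n)` and so factors along it; since the norms of the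
factors are composed of primes of `m` and of `n` respectively, they must be `m` and `n`. Coprimality
of norms gives uniqueness. -/
theorem Ideal.card_absNorm_eq_mul {m n : ℕ} (hm : m ≠ 0) (hn : n ≠ 0) (h : m.Coprime n) :
    Nat.card {I : Ideal R // absNorm I = m * n} =
      Nat.card {I : Ideal R // absNorm I = m} * Nat.card {I : Ideal R // absNorm I = n} := by
  rw [← Nat.card_prod]
  symm
  refine Nat.card_congr (Equiv.ofBijective (fun q : {I : Ideal R // absNorm I = m} ×
    {I : Ideal R // absNorm I = n} ↦ (⟨q.1.1 * q.2.1, by rw [map_mul, q.1.2, q.2.2]⟩ :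
      {I : Ideal R // absNorm I = m * n})) ⟨?_, ?_⟩)
  · rintro ⟨⟨I, hI⟩, ⟨J, hJ⟩⟩ ⟨⟨I', hI'⟩, ⟨J', hJ'⟩⟩ hq
    simp only [Subtype.mk.injEq] at hq
    have h1 : I ∣ I' := (isCoprime_of_coprime_absNorm (by rw [hI, hJ']; exact h)).dvd_of_dvd_mul_right
      (hq ▸ dvd_mul_right I J)
    have h2 : I' ∣ I := (isCoprime_of_coprime_absNorm (by rw [hI', hJ]; exact h)).dvd_of_dvd_mul_right
      (hq ▸ dvd_mul_right I' J')
    obtain rfl : I = I' := dvd_antisymm h1 h2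
    have hI0 : I ≠ 0 := by rintro rfl; rw [map_zero] at hI; exact hm hI.symm
    obtain rfl := mul_left_cancel₀ hI0 hq
    rfl
  · rintro ⟨I, hI⟩
    have h1 : I ∣ span {(m : R)} * span {(n : R)} := by
      rw [span_singleton_mul_span_singleton, dvd_iff_le, span_singleton_le_iff_mem]
      have := absNorm_mem I
      rwa [hI, Nat.cast_mul] at this
    obtain ⟨A, B, hA, hB, rfl⟩ := exists_dvd_and_dvd_of_dvd_mul h1
    have hA' := map_dvd absNorm hA
    have hB' := map_dvd absNorm hB
    rw [absNorm_span_natCast] at hA' hB'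
    rw [map_mul] at hI
    have h2 : absNorm A ∣ m := (Nat.Coprime.coprime_dvd_left hA' (h.pow_left _)).dvd_of_dvd_mul_right
      (hI ▸ dvd_mul_right _ _)
    have h3 : absNorm B ∣ n := (Nat.Coprime.coprime_dvd_left hB' (h.symm.pow_left _)).dvd_of_dvd_mul_left
      (hI ▸ dvd_mul_left _ _)
    obtain ⟨c, hc⟩ := h2
    obtain ⟨e, he⟩ := h3
    have h4 : absNorm A * absNorm B ≠ 0 := by rw [hI]; exact mul_ne_zero hm hn
    have h5 : c * e = 1 := by
      apply Nat.eq_of_mul_eq_mul_left (Nat.pos_of_ne_zero h4)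
      calc _ = (absNorm A * c) * (absNorm B * e) := by ring
        _ = _ := by rw [← hc, ← he, hI, mul_one]
    have hc1 : c = 1 := Nat.eq_one_of_mul_eq_one_right h5
    have he1 : e = 1 := Nat.eq_one_of_mul_eq_one_left h5
    exact ⟨⟨⟨A, by rw [hc, hc1, mul_one]⟩, ⟨B, by rw [he, he1, mul_one]⟩⟩, rfl⟩

end IdealCount

/-! ### Splitting of rational primes, through roots of `X² - X + m`. -/

section QuadraticSplitting

open NumberField Ideal

variable {K : Type*} [Field K] {m : ℕ} {b : Module.Basis (Fin 2) ℤ (𝓞 K)}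

theorem not_natCast_dvd_of_repr_one {q : ℕ} (hq : q.Prime) {x : 𝓞 K} (hx : b.repr x 1 = 1) :
    ¬ (q : 𝓞 K) ∣ x := by
  rintro ⟨y, rfl⟩
  have : (q : 𝓞 K) * y = (q : ℤ) • y := by simp [zsmul_eq_mul]
  rw [this, map_zsmul, Finsupp.smul_apply, smul_eq_mul] at hx
  have := Int.isUnit_iff_natAbs_eq.mp (IsUnit.of_mul_eq_one _ hx)
  exact hq.one_lt.ne' (by simpa using this)

variable [NumberField K]

theorem absNorm_span_natCast_of_basis (b : Module.Basis (Fin 2) ℤ (𝓞 K)) (q : ℕ) :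
    absNorm (span {(q : 𝓞 K)}) = q ^ 2 := by
  rw [absNorm_span_natCast, Module.finrank_eq_card_basis b, Fintype.card_fin]

/-- Every residue class modulo an ideal of prime norm contains an integer. -/
theorem exists_int_sub_mem_of_absNorm_prime {q : ℕ} (hq : q.Prime) {A : Ideal (𝓞 K)}
    (hA : absNorm A = q) (x : 𝓞 K) : ∃ t : ℤ, x - t ∈ A := by
  have : Fact q.Prime := ⟨hq⟩
  have hcard : Nat.card (𝓞 K ⧸ A) = q := by rw [← hA, absNorm_apply, Submodule.cardQuot_apply]
  have h1 : (Ideal.Quotient.mk A 1) ≠ 0 := by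
    rw [Ne, Ideal.Quotient.eq_zero_iff_mem, ← eq_top_iff_one]
    rintro rfl
    rw [absNorm_top] at hA
    exact hq.one_lt.ne hA
  obtain ⟨t, ht⟩ := AddSubgroup.mem_zmultiples_iff.mp
    (mem_zmultiples_of_prime_card (g' := Ideal.Quotient.mk A x) hcard h1)
  refine ⟨t, ?_⟩
  rw [← Ideal.Quotient.eq, ← ht]
  simp

theorem int_dvd_of_mem_of_absNorm_eq {q : ℕ} (hq : q.Prime) {A : Ideal (𝓞 K)}
    (hA : absNorm A = q) {n : ℤ} (hn : (n : 𝓞 K) ∈ A) : (q : ℤ) ∣ n := by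
  have h := Ideal.span_singleton_absNorm (I := A) (hA ▸ hq)
  rw [hA] at h
  rw [← Ideal.mem_span_singleton, h, Ideal.mem_comap]
  simpa using hn

/-- A nontrivial factor of `(q)` has norm `q`, hence residue field with `q` elements; the integer
congruent to `b 1` there is a root of `X² - X + m` modulo `q`. -/
theorem prime_span_natCast_of_inert (hb1 : b 1 ^ 2 = b 1 - m) {q : ℕ} (hq : q.Prime)
    (h : ∀ t : ℤ, ¬ (q : ℤ) ∣ t ^ 2 - t + m) : Prime (span {(q : 𝓞 K)}) := by
  have hN := absNorm_span_natCast_of_basis b q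
  refine UniqueFactorizationMonoid.irreducible_iff_prime.mp ⟨?_, ?_⟩
  · rw [isUnit_iff]
    intro htop
    rw [htop, absNorm_top] at hN
    have := hq.one_lt
    nlinarith
  · intro A B hAB
    rw [hAB, map_mul] at hN
    obtain ⟨i, hi, hAi⟩ := (Nat.dvd_prime_pow hq).mp (hN ▸ dvd_mul_right (absNorm A) (absNorm B))
    interval_cases i
    · left
      rw [pow_zero, absNorm_eq_one_iff] at hAi
      exact isUnit_iff.mpr hAi
    · rw [pow_one] at hAi
      obtain ⟨t, ht⟩ := exists_int_sub_mem_of_absNorm_prime hq hAi (b 1)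
      refine absurd (int_dvd_of_mem_of_absNorm_eq hq hAi (n := t ^ 2 - t + m) ?_) (h t)
      have : ((t ^ 2 - t + m : ℤ) : 𝓞 K) = (1 - b 1 - t) * (b 1 - t) := by
        push_cast
        linear_combination hb1
      rw [this]
      exact A.mul_mem_left _ ht
    · right
      rw [hAi] at hN
      have : absNorm B = 1 := Nat.eq_of_mul_eq_mul_left (pow_pos hq.pos 2) (by rw [hN, mul_one])
      exact isUnit_iff.mpr (absNorm_eq_one_iff.mp this)

theorem exists_prime_sq_eq_span (hb1 : b 1 ^ 2 = b 1 - m) {p : ℕ} (hm : p + 1 = 4 * m) :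
    ∃ P : Ideal (𝓞 K), absNorm P = p ∧ P ^ 2 = span {(p : 𝓞 K)} := by
  have h1 : (p : 𝓞 K) + 1 = 4 * m := by exact_mod_cast congrArg (Nat.cast (R := 𝓞 K)) hm
  have h2 : span {2 * b 1 - 1} ^ 2 = span {(p : 𝓞 K)} := by
    rw [span_singleton_pow, ← span_singleton_neg (p : 𝓞 K)]
    congr 2
    linear_combination 4 * hb1 + h1
  -- `2 * b 1 - 1` is a square root of `-p`.
  refine ⟨span {2 * b 1 - 1}, ?_, h2⟩
  have h3 := congrArg absNorm h2
  rw [map_pow, absNorm_span_natCast_of_basis b] at h3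
  exact Nat.pow_left_injective two_ne_zero h3

/-- The factors are the conjugate ideals `(q, b 1 - t)` and `(q, b 1 - 1 + t)`. The product of the
second generators is `-(t² - t + m)`, a multiple of `q`; their difference is `2t - 1`, prime to `q`,
which puts `q` in the product and keeps the factors distinct. -/
theorem exists_primes_mul_eq_span (hb0 : b 0 = 1) (hb1 : b 1 ^ 2 = b 1 - m) {q : ℕ} (hq : q.Prime) {t : ℤ}
    (ht : (q : ℤ) ∣ t ^ 2 - t + m) (ht' : ¬ (q : ℤ) ∣ 2 * t - 1) :
    ∃ P P' : Ideal (𝓞 K), absNorm P = q ∧ absNorm P' = q ∧ P ≠ P' ∧ P * P' = span {(q : 𝓞 K)} := by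
  set P : Ideal (𝓞 K) := span {(q : 𝓞 K), b 1 - t} with hP
  set P' : Ideal (𝓞 K) := span {(q : 𝓞 K), b 1 - 1 + t} with hP'
  obtain ⟨u, v, huv⟩ : IsCoprime (q : ℤ) (2 * t - 1) :=
    (Prime.coprime_iff_not_dvd (Nat.prime_iff_prime_int.mp hq)).mpr ht'
  have huv' : (u : 𝓞 K) * q + v * (2 * t - 1) = 1 := by exact_mod_cast congrArg (Int.cast (R := 𝓞 K)) huv
  obtain ⟨c, hc⟩ := ht
  have hc' : (t : 𝓞 K) ^ 2 - t + m = q * c := by exact_mod_cast congrArg (Int.cast (R := 𝓞 K)) hc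
  have hPP' : P * P' = span {(q : 𝓞 K)} := by
    rw [hP, hP', span_pair_mul_span_pair]
    refine le_antisymm ?_ ?_
    · rw [span_le]
      rintro x (rfl | rfl | rfl | rfl)
      · exact mem_span_singleton.mpr (dvd_mul_right _ _)
      · exact mem_span_singleton.mpr (dvd_mul_right _ _)
      · exact mem_span_singleton.mpr (dvd_mul_left _ _)
      · exact mem_span_singleton.mpr ⟨-c, by linear_combination hb1 - hc'⟩
    · rw [span_singleton_le_iff_mem]
      have : (q : 𝓞 K) = u * (q * q) + v * (q * (b 1 - 1 + t)) + -v * ((b 1 - t) * q) := by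
        linear_combination -(q : 𝓞 K) * huv'
      refine (congrArg (· ∈ _) this).mpr (add_mem (add_mem (mul_mem_left _ _ (subset_span ?_))
        (mul_mem_left _ _ (subset_span ?_))) (mul_mem_left _ _ (subset_span ?_))) <;> simp
  have hrepr : ∀ n : ℤ, b.repr ((n : 𝓞 K) + b 1) 1 = 1 := fun n ↦ by
    have := (repr_int_add_int_mul hb0 n 1).2
    rwa [Int.cast_one, one_mul] at this
  have hPne : P ≠ ⊤ := fun h ↦ by
    rw [h, top_mul] at hPP'
    have : b 1 - 1 + t ∈ P' := subset_span (by simp)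
    rw [hPP', mem_span_singleton, show b 1 - 1 + (t : 𝓞 K) = ((t - 1 : ℤ) : 𝓞 K) + b 1 by push_cast; ring] at this
    exact not_natCast_dvd_of_repr_one hq (hrepr _) this
  have hPne' : P' ≠ ⊤ := fun h ↦ by
    rw [h, mul_top] at hPP'
    have : b 1 - t ∈ P := subset_span (by simp)
    rw [hPP', mem_span_singleton, show b 1 - (t : 𝓞 K) = ((-t : ℤ) : 𝓞 K) + b 1 by push_cast; ring] at this
    exact not_natCast_dvd_of_repr_one hq (hrepr _) this
  have hN : absNorm P * absNorm P' = q ^ 2 := by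
    rw [← map_mul, hPP', absNorm_span_natCast_of_basis b]
  have hNP : absNorm P = q ∧ absNorm P' = q := by
    have h := (hq.mul_eq_prime_sq_iff ?_ ?_).mp hN
    · exact h
    · rwa [Ne, absNorm_eq_one_iff]
    · rwa [Ne, absNorm_eq_one_iff]
  refine ⟨P, P', hNP.1, hNP.2, fun h ↦ ht' ?_, hPP'⟩
  refine int_dvd_of_mem_of_absNorm_eq hq hNP.1 ?_
  have h1 : b 1 - t ∈ P := subset_span (by simp)
  have h2 : b 1 - 1 + t ∈ P := h ▸ subset_span (by simp)
  convert sub_mem h2 h1 using 1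
  push_cast
  ring

end QuadraticSplitting

/-! ### Quadratic reciprocity: the Legendre symbol decides the splitting. -/

section Reciprocity

variable {p m : ℕ} [Fact p.Prime]

theorem quadraticChar_natCast_eq_neg_one_iff (hp4 : p % 4 = 3) {q : ℕ} [Fact q.Prime] (hq : q ≠ 2) :
    quadraticChar (ZMod p) q = -1 ↔ ¬ IsSquare (-(p : ZMod q)) := by
  have h := FiniteField.isSquare_odd_prime_iff (F := ZMod p) (p := q)
    (ringChar_zmod_ne_two p (by omega)) hq
  rw [quadraticChar_neg_one_iff_not_isSquare, h, ZMod.card, ZMod.χ₄_nat_three_mod_four hp4]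
  push_cast
  rw [neg_one_mul, ne_eq, not_not, quadraticChar_neg_one_iff_not_isSquare]

theorem exists_dvd_of_quadraticChar_eq_one (hp4 : p % 4 = 3) (hm : p + 1 = 4 * m) {q : ℕ} (hq : q.Prime)
    (h : quadraticChar (ZMod p) q = 1) : ∃ t : ℤ, (q : ℤ) ∣ t ^ 2 - t + m ∧ ¬ (q : ℤ) ∣ 2 * t - 1 := by
  have := Fact.mk hq
  have hmZ : (p : ℤ) + 1 = 4 * m := by exact_mod_cast hm
  rcases eq_or_ne q 2 with rfl | hq2
  · have h0 : (2 : ZMod p) ≠ 0 := by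
      intro h0
      rw [Nat.cast_two, h0, quadraticChar_zero] at h
      exact zero_ne_one h
    rw [Nat.cast_two, quadraticChar_one_iff_isSquare h0, ZMod.exists_sq_eq_two_iff (by rintro rfl; omega)] at h
    have h2 : 2 ∣ m := by omega
    -- If 2 is a square modulo `p`, then `p % 8 = 7` and `m` is even, so `t = 0` is a root.
    exact ⟨0, by simpa using Int.natCast_dvd_natCast.mpr h2, by norm_num⟩
  · have hodd : ¬ 2 ∣ q := fun h2 ↦ hq2 ((Nat.prime_dvd_prime_iff_eq Nat.prime_two hq).mp h2).symm
    have hpq : (p : ZMod q) ≠ 0 := by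
      intro h0
      rw [ZMod.natCast_eq_zero_iff, Nat.prime_dvd_prime_iff_eq hq Fact.out] at h0
      subst h0
      simp at h
    have hsq : IsSquare (-(p : ZMod q)) := by
      by_contra hns
      rw [← quadraticChar_natCast_eq_neg_one_iff hp4 hq2, h] at hns
      norm_num at hns
    obtain ⟨y, hy⟩ := hsq
    have h20 : (2 : ZMod q) ≠ 0 := by
      intro h0
      have : ((2 : ℕ) : ZMod q) = 0 := by exact_mod_cast h0
      rw [ZMod.natCast_eq_zero_iff, Nat.prime_dvd_prime_iff_eq hq Nat.prime_two] at this
      exact hq2 this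
    have hmq : (p : ZMod q) + 1 = 4 * m := by exact_mod_cast congrArg (Nat.cast (R := ZMod q)) hm
    -- The quadratic formula: `4 (t² - t + m) = (2t - 1)² + p`, with `y² = -p`.
    obtain ⟨t, ht⟩ := ZMod.intCast_surjective ((y + 1) / 2)
    have ht2 : 2 * (t : ZMod q) - 1 = y := by rw [ht]; field_simp; ring
    refine ⟨t, ?_, ?_⟩
    · rw [← ZMod.intCast_zmod_eq_zero_iff_dvd]
      push_cast
      apply mul_left_cancel₀ (mul_ne_zero h20 h20)
      linear_combination (2 * (t : ZMod q) - 1 + y) * ht2 - hy - hmq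
    · rw [← ZMod.intCast_zmod_eq_zero_iff_dvd]
      push_cast
      rw [ht2]
      rintro rfl
      exact hpq (by simpa using hy)

theorem not_dvd_of_quadraticChar_eq_neg_one (hp4 : p % 4 = 3) (hm : p + 1 = 4 * m) {q : ℕ} (hq : q.Prime)
    (h : quadraticChar (ZMod p) q = -1) (t : ℤ) : ¬ (q : ℤ) ∣ t ^ 2 - t + m := by
  have := Fact.mk hq
  intro hd
  rcases eq_or_ne q 2 with rfl | hq2
  · rw [Nat.cast_two, quadraticChar_neg_one_iff_not_isSquare, ZMod.exists_sq_eq_two_iff (by rintro rfl; omega)] at h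
    have h1 : (2 : ℤ) ∣ t ^ 2 - t := by
      rw [show t ^ 2 - t = (t - 1) * (t - 1 + 1) by ring]
      exact (Int.even_mul_succ_self (t - 1)).two_dvd
    push_cast at hd
    have h2 : (2 : ℤ) ∣ m := (dvd_add_right h1).mp hd
    omega
  · rw [quadraticChar_natCast_eq_neg_one_iff hp4 hq2] at h
    refine h ⟨2 * t - 1, ?_⟩
    rw [← ZMod.intCast_zmod_eq_zero_iff_dvd] at hd
    push_cast at hd
    have hmq : (p : ZMod q) + 1 = 4 * m := by exact_mod_cast congrArg (Nat.cast (R := ZMod q)) hm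
    linear_combination -4 * hd - hmq

end Reciprocity

/-! ### Factorization of the Dedekind zeta function and the class number formula. -/

section ClassNumberFormula

open NumberField Ideal Filter Topology

theorem DirichletCharacter.zetaMul_prime_pow {N : ℕ} (χ : DirichletCharacter ℂ N) {q : ℕ}
    (hq : q.Prime) (k : ℕ) : χ.zetaMul (q ^ k) = ∑ i ∈ Finset.range (k + 1), χ q ^ i := by
  rw [zetaMul, ArithmeticFunction.coe_zeta_mul_apply, Nat.sum_divisors_prime_pow hq]
  refine Finset.sum_congr rfl fun i _ ↦ ?_
  rw [← χ.apply_eq_toArithmeticFunction_apply (pow_ne_zero i hq.ne_zero), Nat.cast_pow, map_pow]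

theorem DirichletCharacter.LSeries_zetaMul {N : ℕ} [NeZero N] (χ : DirichletCharacter ℂ N) {s : ℂ}
    (hs : 1 < s.re) : LSeries χ.zetaMul s = riemannZeta s * χ.LFunction s := by
  rw [zetaMul, ← ArithmeticFunction.coe_mul, LSeries_convolution', χ.LFunction_eq_LSeries hs]
  · congr 1
    · simp_rw [← ArithmeticFunction.LSeries_zeta_eq_riemannZeta hs, ← ArithmeticFunction.natCoe_apply]
    · exact (LSeries_congr χ.apply_eq_toArithmeticFunction_apply s).symm
  · exact ArithmeticFunction.LSeriesSummable_zeta_iff.mpr hs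
  · exact (LSeriesSummable_congr _ fun h ↦ (χ.apply_eq_toArithmeticFunction_apply h).symm).mpr <|
      ZMod.LSeriesSummable_of_one_lt_re χ hs

variable {K : Type*} [Field K] [NumberField K] {p m : ℕ} [Fact p.Prime]
  {b : Module.Basis (Fin 2) ℤ (𝓞 K)}

theorem card_absNorm_eq_prime_pow (hb0 : b 0 = 1) (hb1 : b 1 ^ 2 = b 1 - m) (hp4 : p % 4 = 3)
    (hm : p + 1 = 4 * m) {q : ℕ} (hq : q.Prime) (k : ℕ) :
    (Nat.card {I : Ideal (𝓞 K) // absNorm I = q ^ k} : ℂ) =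
      (legendreDirichletCharacter p).zetaMul (q ^ k) := by
  rw [DirichletCharacter.zetaMul_prime_pow _ hq, legendreDirichletCharacter_apply]
  rcases (quadraticChar_isQuadratic (ZMod p)) q with h | h | h
  · rw [quadraticChar_eq_zero_iff, ZMod.natCast_eq_zero_iff,
      Nat.prime_dvd_prime_iff_eq Fact.out hq] at h
    subst h
    obtain ⟨P, hP, hP2⟩ := exists_prime_sq_eq_span hb1 hm
    rw [card_absNorm_eq_pow_of_ramified hq hP hP2]
    simp
  · obtain ⟨t, ht, ht'⟩ := exists_dvd_of_quadraticChar_eq_one hp4 hm hq h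
    obtain ⟨P, P', hP, hP', hne, hPP'⟩ := exists_primes_mul_eq_span hb0 hb1 hq ht ht'
    rw [card_absNorm_eq_pow_of_split hq hP hP' hne hPP', h]
    simp
  · rw [card_absNorm_eq_pow_of_inert hq (prime_span_natCast_of_inert hb1 hq
      (not_dvd_of_quadraticChar_eq_neg_one hp4 hm hq h)) (absNorm_span_natCast_of_basis b q), h]
    push_cast
    rw [neg_one_geom_sum]
    simp only [Nat.even_add_one, ite_not]

theorem card_absNorm_eq_zetaMul (hb0 : b 0 = 1) (hb1 : b 1 ^ 2 = b 1 - m) (hp4 : p % 4 = 3)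
    (hm : p + 1 = 4 * m) {n : ℕ} (hn : n ≠ 0) :
    (Nat.card {I : Ideal (𝓞 K) // absNorm I = n} : ℂ) = (legendreDirichletCharacter p).zetaMul n := by
  -- The zero ideal has norm 0, so the plain count does not vanish at 0; `toArithmeticFunction`
  -- resets that value.
  let r : ArithmeticFunction ℂ :=
    toArithmeticFunction fun n ↦ (Nat.card {I : Ideal (𝓞 K) // absNorm I = n} : ℂ)
  have hr : ∀ {n : ℕ}, n ≠ 0 → r n = Nat.card {I : Ideal (𝓞 K) // absNorm I = n} := fun {n} hn ↦
    if_neg hn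
  have hmul : r.IsMultiplicative := by
    refine ArithmeticFunction.IsMultiplicative.iff_ne_zero.mpr ⟨?_, fun {a c} ha hc hac ↦ ?_⟩
    · have : Nat.card {I : Ideal (𝓞 K) // absNorm I = 1} = 1 := by simp
      rw [hr one_ne_zero, this, Nat.cast_one]
    · rw [hr (mul_ne_zero ha hc), hr ha, hr hc, card_absNorm_eq_mul ha hc hac, Nat.cast_mul]
  have key : r = (legendreDirichletCharacter p).zetaMul :=
    (ArithmeticFunction.IsMultiplicative.eq_iff_eq_on_prime_powers _ hmul _
      (legendreDirichletCharacter p).isMultiplicative_zetaMul).mpr fun q k hq ↦ by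
        rw [hr (pow_ne_zero k hq.ne_zero), card_absNorm_eq_prime_pow hb0 hb1 hp4 hm hq]
  rw [← key, hr hn]

/-- For real `s > 1` the ideal count gives `ζ_K(s) = ζ(s) L(s, χ)`; multiply by `s - 1` and let `s`
decrease to 1, where `L(s, χ)` is continuous because `χ` is nontrivial. -/
theorem dedekindZeta_residue_eq_LFunction (hb0 : b 0 = 1) (hb1 : b 1 ^ 2 = b 1 - m)
    (hp4 : p % 4 = 3) (hm : p + 1 = 4 * m) :
    (dedekindZeta_residue K : ℂ) = (legendreDirichletCharacter p).LFunction 1 := by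
  have hp2 : p ≠ 2 := by rintro rfl; omega
  have hcast : Tendsto (fun s : ℝ ↦ (s : ℂ)) (𝓝[>] 1) (𝓝[≠] 1) := by
    refine tendsto_nhdsWithin_iff.mpr ⟨?_, ?_⟩
    · exact (Complex.continuous_ofReal.tendsto' 1 1 Complex.ofReal_one).mono_left nhdsWithin_le_nhds
    · filter_upwards [self_mem_nhdsWithin] with s hs
      exact Complex.ofReal_ne_one.mpr (ne_of_gt hs)
  have h1 : Tendsto (fun s : ℝ ↦ ((s : ℂ) - 1) * dedekindZeta K s) (𝓝[>] 1)
      (𝓝 (1 * (legendreDirichletCharacter p).LFunction 1)) := by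
    refine ((riemannZeta_residue_one.comp hcast).mul
      ((((legendreDirichletCharacter p).differentiable_LFunction
        (legendreDirichletCharacter_ne_one p hp2)).continuous.tendsto 1).comp
          (hcast.mono_right nhdsWithin_le_nhds))).congr' ?_
    filter_upwards [self_mem_nhdsWithin] with s hs
    have hs' : 1 < (s : ℂ).re := by simpa using hs
    rw [dedekindZeta, LSeries_congr (fun hn ↦ card_absNorm_eq_zetaMul hb0 hb1 hp4 hm hn),
      DirichletCharacter.LSeries_zetaMul _ hs', Function.comp_apply, Function.comp_apply, mul_assoc]
  rw [one_mul] at h1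
  exact tendsto_nhds_unique (tendsto_sub_one_mul_dedekindZeta_nhdsGT K) h1

/-- The Dirichlet class number formula for `ℚ(√-p)`, in its finite form. -/
theorem sum_quadraticChar_mul_val_eq (hp4 : p % 4 = 3) (hp3 : 3 < p) {α : K} (hα : α ^ 2 = -(p : K))
    (htop : IntermediateField.adjoin ℚ {α} = ⊤) :
    ∑ x : ZMod p, quadraticChar (ZMod p) x * x.val = -(p * (classNumber K : ℤ)) := by
  obtain ⟨m, hm⟩ : ∃ m, p + 1 = 4 * m := ⟨(p + 1) / 4, by omega⟩
  obtain ⟨b, hb0, hb1⟩ := exists_basis_ringOfIntegers Fact.out hm hα htop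
  have h := dedekindZeta_residue_eq_LFunction hb0 hb1 hp4 hm
  rw [dedekindZeta_residue_eq hα hb0 hb1 (by omega) hm,
    LFunction_legendreDirichletCharacter_one p hp4] at h
  have hp0 : (p : ℂ) ≠ 0 := by exact_mod_cast (Fact.out : p.Prime).ne_zero
  have hs0 : ((√p : ℝ) : ℂ) ≠ 0 := by
    have : (0 : ℝ) < p := by exact_mod_cast (Fact.out : p.Prime).pos
    exact_mod_cast (Real.sqrt_pos.mpr this).ne'
  have hpi : (Real.pi : ℂ) ≠ 0 := by exact_mod_cast Real.pi_ne_zero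
  simp only [legendreDirichletCharacter_apply] at h
  push_cast at h
  field_simp at h
  have h' : ∑ x : ZMod p, (quadraticChar (ZMod p) x : ℂ) * (x.val : ℂ) = -(p * (classNumber K : ℂ)) := by
    linear_combination h
  exact_mod_cast h'

end ClassNumberFormula

theorem theorem2
    (p : ℕ) (hp : p.Prime) (hp4 : p % 4 = 3) (hp3 : 3 < p)
    (b : ℕ) [NeZero b] (hb2 : 2 ≤ b) (hb : ¬ IsSquare (b : ZMod p))
    (d : ℕ) (hd : d = orderOf (b : ZMod p))
    (g : ℤ) (hg : IsPrimitiveRoot (g : ZMod p) (p - 1))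
    (K : Type*) [Field K] [NumberField K]
    (hK : ∃ α : K, α ^ 2 = -(p : K) ∧ IntermediateField.adjoin ℚ {α} = ⊤) :
    (∀ j < (p - 1) / d,
      IsLeast {t : ℕ | 0 < t ∧ ∀ k ≥ 1,
        expansionDigit b (residueFraction p g j) (k + t) =
          expansionDigit b (residueFraction p g j) k} d) ∧
    ((∑ j ∈ Finset.range ((p - 1) / d), oddDigitSum p b d g j : ℕ) : ℚ) =
      ((b : ℚ) - 1) * ((p : ℚ) - 1) / 4 -
        ((b : ℚ) + 1) * (NumberField.classNumber K : ℚ) / 2 := by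
  have : Fact p.Prime := ⟨hp⟩
  subst hd
  obtain ⟨α, hα, htop⟩ := hK
  refine ⟨fun j _ ↦ ?_, ?_⟩
  · have hb0 : (b : ZMod p) ≠ 0 := fun h ↦ hb (h ▸ IsSquare.zero)
    have hg0 : (g : ZMod p) ≠ 0 := (hg.isUnit (by omega)).ne_zero
    rw [residueFraction_eq_val_div]
    exact isLeast_period_expansionDigit p b hb2 hb0 _ (pow_ne_zero _ hg0)
  · have h := sum_oddDigitSum_eq p hp4 b hb g hg _ (sum_quadraticChar_mul_val_eq hp4 hp3 hα htop)
    rwa [Int.cast_natCast] at h
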